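/- Let $n>1$ be an integer and let $p$ be an odd prime not dividing $n$. Put $P=\prod_{i=1}^n(x-z_i)$, $$S=\operatorname{Spec}\mathbb Z[z_1,\dots,z_n,(z_i-z_j)^{-1}\ (i\ne j)],$$ let $T\subset\mathbb P^1_S$ be the union of the sections $x=z_i$ and $x=\infty$, and $U=\mathbb P^1_S\setminus T$. Let $\mathcal P^h$ be $\mathcal O_{\mathbb P^1_S}[h,h^{-1}]$ with the logarithmic connection $\nabla f=df+hf\,\frac{dP}{P}$, and let $$E=H^1_{dR,\log}(\mathbb P^1_S/S,\mathcal P^h),$$ the first hypercohomology of $\mathcal O_{\mathbb P^1_S}[h,h^{-1}]\to\Omega^1_{\mathbb P^1_S/S}(\log T)[h,h^{-1}]$, with its Gauss–Manin connection. Put $\mathbb A_p=\mathbb F_p[h,(h^p-h)^{-1}]$ and $E^\flat=E\otimes_{\mathbb Z[h]}\mathbb A_p$. Let $S^\circ\subset S\times\operatorname{Spec}\mathbb Z[n^{-1}]$ be the open subset on which the discriminant $\operatorname{Disc}(\partial P/\partial x)$ is invertible, let $\mathrm{Crit}_P^\circ\subset\mathbb A^1_{S^\circ}$ be the closed subscheme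 $\partial P/\partial x=0$, which is contained in $U$, and let $\nu:\mathrm{Crit}_P^\circ\to S^\circ$ be the projection, which is finite étale. Let $\mathcal L=\nu_*(\mathcal P^h|_{\mathrm{Crit}_P^\circ})$, with connection $$\nabla^{\mathcal L}_{\partial/\partial z_i}f=\theta_i(f)+h\,\frac{\theta_i(P)}{P}f,$$ where $\theta_i$ is the vector field on $\mathrm{Crit}_P^\circ$ lifting $\partial/\partial z_i$. Then, over $S^\circ$ and with coefficients in $\mathbb A_p$, the map on relative 1-forms on $U$ $$C(f\,dx)=-\Big(\big(\nabla_{\partial/\partial x}\big)^{p-1}f\Big)\Big|_{\mathrm{Crit}_P^\circ}$$ vanishes on the forms $\nabla_{\partial/\partial x}(g)\,dx$, hence factors through the relative de Rham cohomology $H^1_{dR}(U/S^\circ,\mathcal P^h\otimes_{\mathbb Z[h]}\mathbb A_p)$; and its composition with the restriction map from $\mathbb P^1$ to $U$ is an isomorphism $$E^\flat|_{S^\circ}\ \xrightarrow{\ \sim\ }\ \mathcal L\otimes_{\mathbb Z[h]}\mathbb A_p$$ of $\mathcal O_{S^\circ}\otimes\mathbb A_p$-modules with connection: it is bijective and linear,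 and it carries the Gauss–Manin connection to $\nabla^{\mathcal L}$. -/

import Mathlib

open Polynomial TensorProduct

namespace KZ

noncomputable section

/-- The unique extension of a derivation of `A` to a formally étale `A`-algebra `B`
(for instance a localization of `A`). -/
def extendDer {R A : Type*} (B : Type*) [CommRing R] [CommRing A] [CommRing B]
    [Algebra R A] [Algebra R B] [Algebra A B] [IsScalarTower R A B] [Algebra.FormallyEtale A B]
    (D : Derivation R A A) : Derivation R B B :=
  (((Algebra.linearMap A B).compDer D).liftKaehlerDifferential.liftBaseChange B ∘ₗ
    (KaehlerDifferential.tensorKaehlerEquivOfFormallyEtale R A B).symm.toLinearMap).compDer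
      (KaehlerDifferential.D R B)

theorem extendDer_algebraMap {R A B : Type*} [CommRing R] [CommRing A] [CommRing B]
    [Algebra R A] [Algebra R B] [Algebra A B] [IsScalarTower R A B] [Algebra.FormallyEtale A B]
    (D : Derivation R A A) (a : A) :
    extendDer B D (algebraMap A B a) = algebraMap A B (D a) := by
  simp [extendDer, KaehlerDifferential.tensorKaehlerEquivOfFormallyEtale_symm_D_algebraMap]

/-- Additive maps satisfying the Leibniz rule along a ring homomorphism `φ` and agreeing on `A`
agree on every localization of `A`. -/
theorem leibniz_ext {A B C : Type*} [CommRing A] [CommRing B] [CommRing C] [Algebra A B]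
    (M : Submonoid A) [IsLocalization M B] (φ : B →+* C) (d₁ d₂ : B → C)
    (h₁ : ∀ x y, d₁ (x * y) = φ x * d₁ y + φ y * d₁ x)
    (h₂ : ∀ x y, d₂ (x * y) = φ x * d₂ y + φ y * d₂ x)
    (h : ∀ a, d₁ (algebraMap A B a) = d₂ (algebraMap A B a)) (b : B) : d₁ b = d₂ b := by
  obtain ⟨⟨a, s⟩, hb⟩ := IsLocalization.surj M b
  have hs : IsUnit (φ (algebraMap A B s)) := (IsLocalization.map_units B s).map φ
  have e₁ := h₁ b (algebraMap A B s)
  have e₂ := h₂ b (algebraMap A B s)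
  simp only at hb
  rw [hb] at e₁ e₂
  apply hs.mul_left_cancel
  linear_combination e₂ - e₁ + h a - φ b * h s

/-- The action of a derivation on polynomials through their coefficients. -/
def coeffDer {B : Type*} [CommRing B] (D : Derivation ℤ B B) : Derivation ℤ B[X] B[X] :=
  letI : Differential B := ⟨D⟩
  Differential.mapCoeffs

theorem coeff_coeffDer {B : Type*} [CommRing B] (D : Derivation ℤ B B) (f : B[X]) (i : ℕ) :
    (coeffDer D f).coeff i = D (f.coeff i) := rfl

@[simp] theorem coeffDer_C {B : Type*} [CommRing B] (D : Derivation ℤ B B) (b : B) :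
    coeffDer D (C b) = C (D b) := by
  let : Differential B := ⟨D⟩
  exact Differential.mapCoeffs_C b

@[simp] theorem coeffDer_X {B : Type*} [CommRing B] (D : Derivation ℤ B B) :
    coeffDer D (X : B[X]) = 0 := by
  let : Differential B := ⟨D⟩
  exact Differential.mapCoeffs_X

theorem derivative_coeffDer {B : Type*} [CommRing B] (D : Derivation ℤ B B) (f : B[X]) :
    derivative (coeffDer D f) = coeffDer D (derivative f) := by
  ext i
  rw [coeff_derivative, coeff_coeffDer, coeff_coeffDer, coeff_derivative, Derivation.leibniz]
  simp [mul_comm]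

theorem natDegree_coeffDer_le {B : Type*} [CommRing B] (D : Derivation ℤ B B) (f : B[X]) :
    (coeffDer D f).natDegree ≤ f.natDegree := by
  rw [natDegree_le_iff_coeff_eq_zero]
  intro i hi
  simp [coeff_coeffDer, coeff_eq_zero_of_natDegree_lt hi]

/-- A `B`-valued point of `S × Spec ℤ[h]`: sections `z i` of the affine line over `B` whose pairwise
differences are invertible, and a parameter `h`. -/
structure Pt (n : ℕ) (B : Type*) [CommRing B] where
  z : Fin n → B
  h : B
  isUnit_sub : ∀ i j, i ≠ j → IsUnit (z i - z j)

namespace Pt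

/-- Base change. -/
def map {n : ℕ} {B B' : Type*} [CommRing B] [CommRing B'] (t : Pt n B) (φ : B →+* B') :
    Pt n B' where
  z i := φ (t.z i)
  h := φ t.h
  isUnit_sub i j hij := by
    rw [← map_sub]
    exact (t.isUnit_sub i j hij).map φ

variable {n : ℕ} {B : Type*} [CommRing B] (t : Pt n B)

/-- The polynomial `P = ∏ (x - z i)`. -/
def P : B[X] := ∏ i, (X - C (t.z i))

/-- Functions on `U`, the complement in `ℙ¹` over `B` of the sections `z i` and `∞`. -/
def F : Type _ := Localization.Away t.P

instance : CommRing t.F := inferInstanceAs (CommRing (Localization.Away t.P))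
instance : Algebra B[X] t.F := inferInstanceAs (Algebra B[X] (Localization.Away t.P))
instance : Algebra B t.F := inferInstanceAs (Algebra B (Localization.Away t.P))
instance : IsScalarTower B B[X] t.F :=
  inferInstanceAs (IsScalarTower B B[X] (Localization.Away t.P))
instance : IsLocalization.Away t.P t.F :=
  inferInstanceAs (IsLocalization.Away t.P (Localization.Away t.P))
instance : Algebra.FormallyEtale B[X] t.F :=
  inferInstanceAs (Algebra.FormallyEtale B[X] (Localization.Away t.P))

/-- A polynomial in `x`, as a function on `U`. -/
abbrev ofPoly : B[X] →+* t.F := algebraMap B[X] t.F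

/-- The function `1 / P` on `U`. -/
def invP : t.F := IsLocalization.Away.invSelf t.P

theorem P_mul_invP : t.ofPoly t.P * t.invP = 1 := IsLocalization.Away.mul_invSelf t.P

/-- The vector field `∂/∂x` on `U`, relative to `B`. -/
def ddx : Derivation B t.F t.F := extendDer t.F derivative'

/-- The vector field on `U` lifting a derivation `D` of `B` and killing `x`. -/
def lift (D : Derivation ℤ B B) : Derivation ℤ t.F t.F := extendDer t.F (coeffDer D)

/-- The connection `∇ = d + h dP/P` of `𝒫^h` on `U`, contracted with a vector field `δ`. -/
def nabla {R : Type*} [CommRing R] [Algebra R t.F] (δ : Derivation R t.F t.F) : t.F →ₗ[R] t.F :=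
  δ.toLinearMap + LinearMap.mulLeft R (algebraMap B t.F t.h * (t.invP * δ (t.ofPoly t.P)))

theorem nabla_apply {R : Type*} [CommRing R] [Algebra R t.F] (δ : Derivation R t.F t.F) (f : t.F) :
    t.nabla δ f = δ f + algebraMap B t.F t.h * (t.invP * δ (t.ofPoly t.P)) * f := rfl

@[simp] theorem ddx_ofPoly (f : B[X]) : t.ddx (t.ofPoly f) = t.ofPoly (derivative f) :=
  extendDer_algebraMap _ _

@[simp] theorem lift_ofPoly (D : Derivation ℤ B B) (f : B[X]) :
    t.lift D (t.ofPoly f) = t.ofPoly (coeffDer D f) :=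
  extendDer_algebraMap _ _

theorem algebraMap_eq (b : B) : algebraMap B t.F b = t.ofPoly (C b) :=
  IsScalarTower.algebraMap_apply B B[X] t.F b

theorem natDegree_P_le : t.P.natDegree ≤ n := by
  refine (natDegree_prod_le _ _).trans ?_
  calc _ ≤ ∑ _i : Fin n, 1 := Finset.sum_le_sum fun i _ => natDegree_X_sub_C_le _
    _ = n := by simp

/-- Functions regular on `𝔸¹` over `B`. -/
def reg₀ : Submodule B t.F := LinearMap.range (IsScalarTower.toAlgHom B B[X] t.F).toLinearMap

theorem mem_reg₀ {f : t.F} : f ∈ t.reg₀ ↔ ∃ a, t.ofPoly a = f := Iff.rfl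

/-- Functions regular on the complement in `ℙ¹` over `B` of the sections `z i`: those of the
form `a / P ^ m` with `deg a ≤ n m`. -/
def regInf : Submodule B t.F where
  carrier := {f | ∃ (m : ℕ) (a : B[X]), a.natDegree ≤ n * m ∧ t.ofPoly t.P ^ m * f = t.ofPoly a}
  zero_mem' := ⟨0, 0, by simp, by simp⟩
  add_mem' := by
    rintro f g ⟨m, a, ha, hf⟩ ⟨k, b, hb, hg⟩
    refine ⟨m + k, t.P ^ k * a + t.P ^ m * b, ?_, ?_⟩
    · have h₁ : (t.P ^ k * a).natDegree ≤ n * (m + k) := by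
        have := natDegree_mul_le (p := t.P ^ k) (q := a)
        have h2 := natDegree_pow_le (p := t.P) (n := k)
        have h3 := Nat.mul_le_mul_left k t.natDegree_P_le
        nlinarith
      have h₂ : (t.P ^ m * b).natDegree ≤ n * (m + k) := by
        have := natDegree_mul_le (p := t.P ^ m) (q := b)
        have h2 := natDegree_pow_le (p := t.P) (n := m)
        have h3 := Nat.mul_le_mul_left m t.natDegree_P_le
        nlinarith
      exact (natDegree_add_le _ _).trans (max_le h₁ h₂)
    · simp only [map_add, map_mul, map_pow, ← hf, ← hg]
      ring
  smul_mem' := by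
    rintro c f ⟨m, a, ha, hf⟩
    refine ⟨m, C c * a, (natDegree_C_mul_le _ _).trans ha, ?_⟩
    rw [Algebra.smul_def, algebraMap_eq, map_mul, ← hf]
    ring

/-- The `f` such that `f dx` is a section over `𝔸¹` of the relative differentials with logarithmic
poles along the sections `z i`. -/
def log₀ : Submodule B t.F := t.reg₀.comap (LinearMap.mulLeft B (t.ofPoly t.P))

/-- The `f` such that `f dx` is a section of the relative differentials with logarithmic pole along
`∞` over the complement of the sections `z i` (in the coordinate `w = 1/x` at infinity,
`f dx = -(x f) dw/w`). -/
def logInf : Submodule B t.F := t.regInf.comap (LinearMap.mulLeft B (t.ofPoly X))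

/-- Čech 1-cocycles `(ω₀, ω_∞, g)` of the relative logarithmic de Rham complex of `𝒫^h` on `ℙ¹`
over `B`, for the affine open cover by `𝔸¹` and the complement of the sections `z i`, whose
intersection is `U`: `ω₀ dx`, `ω_∞ dx` are logarithmic forms on the two charts, `g` is a function on
`U`, and `ω₀ - ω_∞ = ∇ g` on `U`. -/
def Z1 : Submodule B (t.F × t.F × t.F) where
  carrier := {c | c.1 ∈ t.log₀ ∧ c.2.1 ∈ t.logInf ∧ c.1 - c.2.1 = t.nabla t.ddx c.2.2}
  zero_mem' := ⟨zero_mem _, zero_mem _, by simp⟩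
  add_mem' := by
    rintro c d ⟨h₁, h₂, h₃⟩ ⟨k₁, k₂, k₃⟩
    refine ⟨add_mem h₁ k₁, add_mem h₂ k₂, ?_⟩
    simp only [Prod.fst_add, Prod.snd_add, map_add, ← h₃, ← k₃]
    ring
  smul_mem' := by
    rintro b c ⟨h₁, h₂, h₃⟩
    refine ⟨Submodule.smul_mem _ _ h₁, Submodule.smul_mem _ _ h₂, ?_⟩
    simp only [Prod.smul_fst, Prod.smul_snd, map_smul, ← h₃, smul_sub]

/-- The Čech differential in degree zero, `(a₀, a_∞) ↦ (∇ a₀, ∇ a_∞, a₀ - a_∞)`. -/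
def d0 : t.F × t.F →ₗ[B] t.F × t.F × t.F :=
  ((t.nabla t.ddx).comp (LinearMap.fst B _ _)).prod
    (((t.nabla t.ddx).comp (LinearMap.snd B _ _)).prod (LinearMap.fst B _ _ - LinearMap.snd B _ _))

/-- Čech 1-coboundaries: the images under the differential of pairs of regular functions on the two
charts. -/
def B1 : Submodule B (t.F × t.F × t.F) := (t.reg₀.prod t.regInf).map t.d0

/-- The relative logarithmic de Rham cohomology `H¹_{dR,log}(ℙ¹_B / B, 𝒫^h)`: the first
hypercohomology of the two-term complex `𝒪 → Ω¹(log T)` on `ℙ¹` over `B`. -/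
abbrev E : Type _ := t.Z1 ⧸ t.B1.submoduleOf t.Z1


theorem der_invP {R : Type*} [CommRing R] [Algebra R t.F] (δ : Derivation R t.F t.F) :
    δ t.invP = - (t.invP ^ 2 * δ (t.ofPoly t.P)) := by
  have h := congrArg δ t.P_mul_invP
  rw [Derivation.leibniz, Derivation.map_one_eq_zero, smul_eq_mul, smul_eq_mul] at h
  linear_combination t.invP * h - δ t.invP * t.P_mul_invP

theorem lift_algebraMap (D : Derivation ℤ B B) (b : B) :
    t.lift D (algebraMap B t.F b) = algebraMap B t.F (D b) := by
  rw [algebraMap_eq, lift_ofPoly, coeffDer_C, algebraMap_eq]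

theorem lift_ddx (D : Derivation ℤ B B) (f : t.F) : t.lift D (t.ddx f) = t.ddx (t.lift D f) := by
  have h := leibniz_ext (Submonoid.powers t.P) (RingHom.id t.F)
    (fun f => t.lift D (t.ddx f) - t.ddx (t.lift D f)) (fun _ => 0) ?_ (by simp) ?_ f
  · exact sub_eq_zero.1 h
  · intro x y
    simp only [Derivation.leibniz, smul_eq_mul, map_add, RingHom.id_apply]
    ring
  · intro a
    change t.lift D (t.ddx (t.ofPoly a)) - t.ddx (t.lift D (t.ofPoly a)) = 0
    simp [derivative_coeffDer]

theorem nabla_comm (D : Derivation ℤ B B) (hD : D t.h = 0) (f : t.F) :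
    t.nabla (t.lift D) (t.nabla t.ddx f) = t.nabla t.ddx (t.nabla (t.lift D) f) := by
  have e : t.lift D (algebraMap B t.F t.h) = 0 := by rw [lift_algebraMap, hD, map_zero]
  have e' : t.ddx (algebraMap B t.F t.h) = 0 := Derivation.map_algebraMap _ _
  simp only [nabla_apply, map_add, Derivation.leibniz, smul_eq_mul, e, e', der_invP,
    t.lift_ddx D f, t.lift_ddx D (t.ofPoly t.P)]
  ring

/-- A polynomial taking the value `D (z j)` at `z j` for all `j`, so that the vector field
`D + v ∂/∂x` on `𝔸¹` over `B` preserves the divisor of `P` (Lagrange interpolation). -/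
def lagrange (D : Derivation ℤ B B) : B[X] :=
  ∑ j, C (D (t.z j) * ∏ k ∈ Finset.univ.erase j, Ring.inverse (t.z j - t.z k)) *
    ∏ k ∈ Finset.univ.erase j, (X - C (t.z k))

theorem eval_lagrange (D : Derivation ℤ B B) (j : Fin n) :
    (t.lagrange D).eval (t.z j) = D (t.z j) := by
  rw [lagrange, eval_finsetSum, Finset.sum_eq_single j]
  · rw [eval_mul, eval_C, eval_prod, mul_assoc, ← Finset.prod_mul_distrib, Finset.prod_eq_one,
      mul_one]
    intro k hk
    rw [eval_sub, eval_X, eval_C]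
    exact Ring.inverse_mul_cancel _ (t.isUnit_sub j k (Finset.ne_of_mem_erase hk).symm)
  · intro k _ hk
    have h0 : (∏ i ∈ Finset.univ.erase k, (X - C (t.z i))).eval (t.z j) = 0 := by
      rw [eval_prod]
      exact Finset.prod_eq_zero (i := j) (by simp [hk.symm]) (by simp)
    rw [eval_mul, h0, mul_zero]
  · simp

theorem pairwise_coprime : Pairwise (Function.onFun IsCoprime fun i => X - C (t.z i)) :=
  fun i j hij => isCoprime_X_sub_C_of_isUnit_sub (t.isUnit_sub i j hij)

theorem P_dvd (D : Derivation ℤ B B) :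
    t.P ∣ coeffDer D t.P + t.lagrange D * derivative t.P := by
  refine Finset.prod_dvd_of_coprime (t.pairwise_coprime.set_pairwise _) fun j _ => ?_
  have hP : t.P = (X - C (t.z j)) * ∏ k ∈ Finset.univ.erase j, (X - C (t.z k)) :=
    (Finset.mul_prod_erase _ _ (Finset.mem_univ j)).symm
  rw [dvd_iff_isRoot, IsRoot, hP]
  simp only [Derivation.leibniz, smul_eq_mul, map_sub, coeffDer_X, coeffDer_C, derivative_mul,
    derivative_X, derivative_C, eval_add, eval_mul, eval_sub, eval_X, eval_C, eval_lagrange,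
    eval_one, eval_zero, sub_zero]
  ring

/-- The Gauss–Manin connection along `D`, on Čech cochains. On a chart, with a lift `θ` of `D`
to a vector field preserving the divisor, it is the Lie derivative `ω ↦ ∇_θ ω`; the Čech component
is corrected by the contraction of `ω` with the difference of the two lifts. The lifts used are
`D + v ∂/∂x` on `𝔸¹`, where `v` is `lagrange`, and `D` on the complement of the `z i`. The class of
the result does not depend on the lifts, see `gmCochain_indep`. -/
def gmCochain (D : Derivation ℤ B B) : t.F × t.F × t.F →ₗ[ℤ] t.F × t.F × t.F where
  toFun c := (t.nabla (t.lift D) c.1 + t.nabla t.ddx (t.ofPoly (t.lagrange D) * c.1),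
    t.nabla (t.lift D) c.2.1, t.nabla (t.lift D) c.2.2 + t.ofPoly (t.lagrange D) * c.1)
  map_add' c d := by
    ext
    · simp only [Prod.fst_add, mul_add, map_add]; abel
    · simp
    · simp only [Prod.fst_add, Prod.snd_add, mul_add, map_add]; abel
  map_smul' m c := by
    ext
    · simp only [Prod.smul_fst, mul_smul_comm, map_zsmul, smul_add, eq_intCast, Int.cast_id]
    · simp only [Prod.smul_fst, Prod.smul_snd, map_zsmul, eq_intCast, Int.cast_id]
    · simp only [Prod.smul_fst, Prod.smul_snd, mul_smul_comm, map_zsmul, smul_add, eq_intCast,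
        Int.cast_id]

theorem nabla_mul {R : Type*} [CommRing R] [Algebra R t.F] (δ : Derivation R t.F t.F)
    (f g : t.F) : t.nabla δ (f * g) = δ f * g + f * t.nabla δ g := by
  simp only [nabla_apply, Derivation.leibniz, smul_eq_mul]
  ring

theorem nabla_mem_regInf {R : Type*} [CommRing R] [Algebra R t.F] (δ : Derivation R t.F t.F)
    (d : B[X] → B[X]) (hδ : ∀ a, δ (t.ofPoly a) = t.ofPoly (d a))
    (hd : ∀ a, (d a).natDegree ≤ a.natDegree) {f : t.F} (hf : f ∈ t.regInf) :
    t.nabla δ f ∈ t.regInf := by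
  obtain ⟨m, a, ha, h⟩ := hf
  refine ⟨m + 1, t.P * d a - C (m : B) * (a * d t.P) + C t.h * (a * d t.P), ?_, ?_⟩
  · have hP := t.natDegree_P_le
    have h1 := hd a
    have h2 := hd t.P
    have h3 := natDegree_mul_le (p := t.P) (q := d a)
    have h4 := natDegree_mul_le (p := a) (q := d t.P)
    have h5 := natDegree_C_mul_le (m : B) (a * d t.P)
    have h6 := natDegree_C_mul_le t.h (a * d t.P)
    have e : n * (m + 1) = n * m + n := by ring
    refine (natDegree_add_le _ _).trans (max_le ((natDegree_sub_le _ _).trans (max_le ?_ ?_)) ?_) <;>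
      omega
  · have e := congrArg δ h
    rw [Derivation.leibniz, Derivation.leibniz_pow, hδ, hδ, smul_eq_mul,
      smul_eq_mul, nsmul_eq_mul, smul_eq_mul] at e
    simp only [nabla_apply, hδ, map_add, map_sub, map_mul, ← h, ← e, algebraMap_eq, pow_succ]
    have hm : t.ofPoly (C (m : B)) = (m : t.F) := by simp
    rw [hm]
    rcases m with _ | m
    · simp only [pow_zero, Nat.cast_zero]
      linear_combination (t.ofPoly (C t.h) * t.ofPoly (d t.P) * f) * t.P_mul_invP
    · simp only [Nat.add_sub_cancel, pow_succ]
      linear_combination (t.ofPoly t.P ^ m * t.ofPoly t.P *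
        t.ofPoly (C t.h) * t.ofPoly (d t.P) * f) * t.P_mul_invP

theorem nabla_lift_mem_regInf (D : Derivation ℤ B B) {f : t.F} (hf : f ∈ t.regInf) :
    t.nabla (t.lift D) f ∈ t.regInf :=
  t.nabla_mem_regInf _ _ (t.lift_ofPoly D) (natDegree_coeffDer_le D) hf

theorem B1_le_Z1 : t.B1 ≤ t.Z1 := by
  rintro _ ⟨⟨a, b⟩, ⟨⟨f, hf⟩, hb⟩, rfl⟩
  change t.ofPoly f = a at hf
  subst hf
  refine ⟨?_, ?_, (map_sub (t.nabla t.ddx) (t.ofPoly f) b).symm⟩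
  · change t.ofPoly t.P * t.nabla t.ddx (t.ofPoly f) ∈ t.reg₀
    refine t.mem_reg₀.2 ⟨t.P * derivative f + C t.h * derivative t.P * f, ?_⟩
    simp only [nabla_apply, ddx_ofPoly, map_add, map_mul, algebraMap_eq]
    linear_combination (- t.ofPoly (C t.h) * t.ofPoly (derivative t.P) * t.ofPoly f) * t.P_mul_invP
  · change t.ofPoly X * t.nabla t.ddx b ∈ t.regInf
    have := t.nabla_mem_regInf (t.ofPoly X • t.ddx) (fun a => X * derivative a)
      
      (fun a => by rw [Derivation.smul_apply, smul_eq_mul, ddx_ofPoly, map_mul]) (fun a => ?_) hb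
    · convert this using 1
      simp only [nabla_apply, Derivation.smul_apply, smul_eq_mul]
      ring
    · rw [natDegree_le_iff_coeff_eq_zero]
      rintro (_ | i) hi
      · simp
      · rw [coeff_X_mul, coeff_derivative, coeff_eq_zero_of_natDegree_lt hi, zero_mul]

theorem gmCochain_mem (D : Derivation ℤ B B) (hD : D t.h = 0) {c : t.F × t.F × t.F}
    (hc : c ∈ t.Z1) : t.gmCochain D c ∈ t.Z1 := by
  obtain ⟨⟨a, ha⟩, h₂, h₃⟩ := hc
  obtain ⟨r, hr⟩ := t.P_dvd D
  refine ⟨?_, ?_, ?_⟩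
  · change t.ofPoly a = t.ofPoly t.P * c.1 at ha
    change t.ofPoly t.P *
      (t.nabla (t.lift D) c.1 + t.nabla t.ddx (t.ofPoly (t.lagrange D) * c.1)) ∈ t.reg₀
    refine t.mem_reg₀.2
      ⟨coeffDer D a + derivative (t.lagrange D * a) + C (t.h - 1) * r * a, ?_⟩
    have e₁ := congrArg (t.lift D) ha
    have e₂ := congrArg t.ddx ha
    have hr' := congrArg t.ofPoly hr
    simp only [lift_ofPoly, ddx_ofPoly, Derivation.leibniz, smul_eq_mul] at e₁ e₂
    simp only [map_add, map_mul] at hr'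
    simp only [nabla_apply, lift_ofPoly, ddx_ofPoly, Derivation.leibniz, smul_eq_mul, map_add,
      map_mul, e₁, e₂, algebraMap_eq, derivative_mul, ha, map_sub, map_one]
    linear_combination (-(t.ofPoly (C t.h) - 1) * c.1) * hr' - (t.ofPoly (C t.h) *
      (t.ofPoly (coeffDer D t.P) + t.ofPoly (derivative t.P) * t.ofPoly (t.lagrange D)) *
      c.1) * t.P_mul_invP
  · have := t.nabla_lift_mem_regInf D h₂
    change t.ofPoly X * t.nabla (t.lift D) c.2.1 ∈ t.regInf
    change t.nabla (t.lift D) (t.ofPoly X * c.2.1) ∈ t.regInf at this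
    rw [nabla_mul, lift_ofPoly, coeffDer_X, map_zero, zero_mul, zero_add] at this
    exact this
  · change t.nabla (t.lift D) c.1 + t.nabla t.ddx (t.ofPoly (t.lagrange D) * c.1) -
      t.nabla (t.lift D) c.2.1 =
      t.nabla t.ddx (t.nabla (t.lift D) c.2.2 + t.ofPoly (t.lagrange D) * c.1)
    rw [map_add, ← t.nabla_comm D hD, ← h₃, map_sub]
    ring

theorem gmCochain_mem_B1 (D : Derivation ℤ B B) (hD : D t.h = 0) {c : t.F × t.F × t.F}
    (hc : c ∈ t.B1) : t.gmCochain D c ∈ t.B1 := by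
  obtain ⟨⟨a, b⟩, ⟨⟨f, hf⟩, hb⟩, rfl⟩ := hc
  change t.ofPoly f = a at hf
  subst hf
  obtain ⟨r, hr⟩ := t.P_dvd D
  have hr' := congrArg t.ofPoly hr
  simp only [map_add, map_mul] at hr'
  refine ⟨(t.nabla (t.lift D) (t.ofPoly f) + t.ofPoly (t.lagrange D) * t.nabla t.ddx (t.ofPoly f),
    t.nabla (t.lift D) b), ⟨?_, t.nabla_lift_mem_regInf D hb⟩, ?_⟩
  · refine t.mem_reg₀.2 ⟨coeffDer D f + t.lagrange D * derivative f + C t.h * r * f, ?_⟩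
    simp only [nabla_apply, lift_ofPoly, ddx_ofPoly, map_add, map_mul, algebraMap_eq]
    linear_combination (-t.ofPoly (C t.h) * t.ofPoly f * t.invP) * hr' - (t.ofPoly (C t.h) *
      t.ofPoly f * t.ofPoly r) * t.P_mul_invP
  · change (t.nabla t.ddx _, t.nabla t.ddx (t.nabla (t.lift D) b), _) =
      (t.nabla (t.lift D) (t.nabla t.ddx (t.ofPoly f)) + t.nabla t.ddx (t.ofPoly (t.lagrange D) *
        t.nabla t.ddx (t.ofPoly f)), t.nabla (t.lift D) (t.nabla t.ddx b),
        t.nabla (t.lift D) (t.ofPoly f - b) +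
          t.ofPoly (t.lagrange D) * t.nabla t.ddx (t.ofPoly f))
    refine Prod.ext ?_ (Prod.ext ?_ ?_)
    · change t.nabla t.ddx (t.nabla (t.lift D) (t.ofPoly f) +
        t.ofPoly (t.lagrange D) * t.nabla t.ddx (t.ofPoly f)) = t.nabla (t.lift D)
          (t.nabla t.ddx (t.ofPoly f)) + t.nabla t.ddx (t.ofPoly (t.lagrange D) *
            t.nabla t.ddx (t.ofPoly f))
      rw [map_add, t.nabla_comm D hD]
    · exact (t.nabla_comm D hD b).symm
    · change (t.nabla (t.lift D) (t.ofPoly f) + t.ofPoly (t.lagrange D) *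
        t.nabla t.ddx (t.ofPoly f)) - t.nabla (t.lift D) b = t.nabla (t.lift D) (t.ofPoly f - b) +
          t.ofPoly (t.lagrange D) * t.nabla t.ddx (t.ofPoly f)
      rw [map_sub]
      ring

theorem separable_P : t.P.Separable :=
  separable_prod t.pairwise_coprime fun _ => separable_X_sub_C

theorem mul_mem_regInf {f g : t.F} (hf : f ∈ t.regInf) (hg : g ∈ t.regInf) : f * g ∈ t.regInf := by
  obtain ⟨m, a, ha, hf⟩ := hf
  obtain ⟨k, b, hb, hg⟩ := hg
  refine ⟨m + k, a * b, ?_, by rw [map_mul, ← hf, ← hg]; ring⟩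
  rw [mul_add]
  exact natDegree_mul_le.trans (add_le_add ha hb)

/-- Other choices of lifts of `D` to logarithmic vector fields on the two charts, `D + v ∂/∂x` on
`𝔸¹` and `D + x r ∂/∂x` on the complement of the `z i`, change the Gauss–Manin connection only
by coboundaries. -/
theorem gmCochain_indep (D : Derivation ℤ B B) (v : B[X])
    (hv : t.P ∣ coeffDer D t.P + v * derivative t.P) (r : t.F) (hr : r ∈ t.regInf)
    {c : t.F × t.F × t.F} (hc : c ∈ t.Z1) :
    ((t.nabla (t.lift D) c.1 + t.nabla t.ddx (t.ofPoly v * c.1),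
      t.nabla (t.lift D) c.2.1 + t.nabla t.ddx (t.ofPoly X * r * c.2.1),
      t.nabla (t.lift D) c.2.2 + t.ofPoly v * c.1 - t.ofPoly X * r * c.2.1) : t.F × t.F × t.F) -
      t.gmCochain D c ∈ t.B1 := by
  obtain ⟨⟨a, ha⟩, h₂, -⟩ := hc
  change t.ofPoly a = t.ofPoly t.P * c.1 at ha
  have hu : t.P ∣ v - t.lagrange D := by
    refine IsCoprime.dvd_of_dvd_mul_right (z := derivative t.P) t.separable_P ?_
    have := dvd_sub hv (t.P_dvd D)
    rwa [add_sub_add_left_eq_sub, ← sub_mul] at this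
  obtain ⟨q, hq⟩ := hu
  have hq' := congrArg t.ofPoly hq
  rw [map_sub, map_mul] at hq'
  refine ⟨((t.ofPoly v - t.ofPoly (t.lagrange D)) * c.1, t.ofPoly X * r * c.2.1), ⟨?_, ?_⟩, ?_⟩
  · refine t.mem_reg₀.2 ⟨q * a, ?_⟩
    rw [hq', map_mul, ha]
    ring
  · change t.ofPoly X * r * c.2.1 ∈ t.regInf
    rw [mul_assoc, mul_left_comm]
    exact t.mul_mem_regInf hr h₂
  · change (t.nabla t.ddx ((t.ofPoly v - t.ofPoly (t.lagrange D)) * c.1),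
      t.nabla t.ddx (t.ofPoly X * r * c.2.1),
      (t.ofPoly v - t.ofPoly (t.lagrange D)) * c.1 - t.ofPoly X * r * c.2.1) =
      (t.nabla (t.lift D) c.1 + t.nabla t.ddx (t.ofPoly v * c.1) -
        (t.nabla (t.lift D) c.1 + t.nabla t.ddx (t.ofPoly (t.lagrange D) * c.1)),
       t.nabla (t.lift D) c.2.1 + t.nabla t.ddx (t.ofPoly X * r * c.2.1) -
        t.nabla (t.lift D) c.2.1,
       t.nabla (t.lift D) c.2.2 + t.ofPoly v * c.1 - t.ofPoly X * r * c.2.1 -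
        (t.nabla (t.lift D) c.2.2 + t.ofPoly (t.lagrange D) * c.1))
    refine Prod.ext ?_ (Prod.ext ?_ ?_)
    · simp only [sub_mul, map_sub]; abel
    · simp only; abel
    · simp only; ring

/-- The Gauss–Manin connection on Čech cocycles. -/
def gmCocycle (D : Derivation ℤ B B) (hD : D t.h = 0) : t.Z1 →ₗ[ℤ] t.Z1 where
  toFun c := ⟨t.gmCochain D c, t.gmCochain_mem D hD c.2⟩
  map_add' c d := Subtype.ext (map_add (t.gmCochain D) (c : t.F × t.F × t.F) d)
  map_smul' m c := Subtype.ext (map_smul (t.gmCochain D) m (c : t.F × t.F × t.F))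

/-- The Gauss–Manin connection on `E` along a derivation `D` of the base killing `h`. -/
def gaussManin (D : Derivation ℤ B B) (hD : D t.h = 0) : t.E →ₗ[ℤ] t.E :=
  (Submodule.Quotient.restrictScalarsEquiv ℤ (t.B1.submoduleOf t.Z1)).toLinearMap ∘ₗ
    Submodule.mapQ _ _ (t.gmCocycle D hD) (fun _ hc => t.gmCochain_mem_B1 D hD hc) ∘ₗ
    (Submodule.Quotient.restrictScalarsEquiv ℤ (t.B1.submoduleOf t.Z1)).symm.toLinearMap

theorem gaussManin_mk (D : Derivation ℤ B B) (hD : D t.h = 0) (c : t.Z1) :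
    t.gaussManin D hD (Submodule.Quotient.mk c) =
      Submodule.Quotient.mk (t.gmCocycle D hD c) := rfl

theorem gmCochain_smul (D : Derivation ℤ B B) (b : B) (c : t.F × t.F × t.F) :
    t.gmCochain D (b • c) = D b • c + b • t.gmCochain D c := by
  have h (f : t.F) :
      t.nabla (t.lift D) (b • f) = D b • f + b • t.nabla (t.lift D) f := by
    rw [Algebra.smul_def, nabla_mul, lift_algebraMap, Algebra.smul_def, Algebra.smul_def]
  refine Prod.ext ?_ (Prod.ext (h c.2.1) ?_)
  · change t.nabla (t.lift D) (b • c.1) + t.nabla t.ddx (t.ofPoly (t.lagrange D) * (b • c.1)) =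
      D b • c.1 + b • (t.nabla (t.lift D) c.1 + t.nabla t.ddx (t.ofPoly (t.lagrange D) * c.1))
    rw [h, mul_smul_comm, map_smul, smul_add, add_assoc]
  · change t.nabla (t.lift D) (b • c.2.2) + t.ofPoly (t.lagrange D) * (b • c.1) =
      D b • c.2.2 + b • (t.nabla (t.lift D) c.2.2 + t.ofPoly (t.lagrange D) * c.1)
    rw [h, mul_smul_comm, smul_add, add_assoc]

theorem gaussManin_smul (D : Derivation ℤ B B) (hD : D t.h = 0) (b : B) (e : t.E) :
    t.gaussManin D hD (b • e) = D b • e + b • t.gaussManin D hD e := by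
  obtain ⟨c, rfl⟩ := Submodule.Quotient.mk_surjective _ e
  rw [← Submodule.Quotient.mk_smul, gaussManin_mk, gaussManin_mk, ← Submodule.Quotient.mk_smul,
    ← Submodule.Quotient.mk_smul, ← Submodule.Quotient.mk_add]
  congr 1
  exact Subtype.ext (t.gmCochain_smul D b c)

/-- Functions on the critical locus `Crit_P ⊂ 𝔸¹` over `B`, defined by `∂P/∂x = 0`. -/
def Crit : Type _ := B[X] ⧸ Ideal.span {derivative t.P}

instance : CommRing t.Crit := inferInstanceAs (CommRing (B[X] ⧸ Ideal.span {derivative t.P}))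
instance : Algebra B t.Crit := inferInstanceAs (Algebra B (B[X] ⧸ Ideal.span {derivative t.P}))

/-- Restriction of polynomials to the critical locus. -/
def polyToCrit : B[X] →ₐ[B] t.Crit := Ideal.Quotient.mkₐ B (Ideal.span {derivative t.P})

theorem polyToCrit_surjective : Function.Surjective t.polyToCrit := Ideal.Quotient.mk_surjective

theorem polyToCrit_eq_zero {f : B[X]} : t.polyToCrit f = 0 ↔ derivative t.P ∣ f :=
  Ideal.Quotient.eq_zero_iff_dvd _ _

/-- The critical locus is contained in `U`. -/
theorem isUnit_polyToCrit_P : IsUnit (t.polyToCrit t.P) := by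
  obtain ⟨a, b, hab⟩ := t.separable_P
  refine IsUnit.of_mul_eq_one (t.polyToCrit a) ?_
  have e := congrArg t.polyToCrit hab
  rw [map_add, map_mul, map_mul, t.polyToCrit_eq_zero.2 (dvd_refl (derivative t.P)), map_one] at e
  linear_combination e

/-- Restriction of functions from `U` to the critical locus. -/
def toCrit : t.F →ₐ[B] t.Crit :=
  IsLocalization.liftAlgHom (M := Submonoid.powers t.P) (f := t.polyToCrit) (by
    rintro ⟨_, m, rfl⟩
    change IsUnit (t.polyToCrit (t.P ^ m))
    rw [map_pow]
    exact t.isUnit_polyToCrit_P.pow m)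

theorem toCrit_ofPoly (f : B[X]) : t.toCrit (t.ofPoly f) = t.polyToCrit f :=
  IsLocalization.lift_eq _ _

/-- The projection `Crit_P → Spec B` is étale: `∂²P/∂x²` is invertible on `Crit_P`. -/
def IsEtaleCrit : Prop := IsCoprime (derivative t.P) (derivative (derivative t.P))

/-- A polynomial restricting to the inverse of `∂²P/∂x²` on the critical locus. -/
def invHess (ht : t.IsEtaleCrit) : B[X] := ht.choose_spec.choose

theorem polyToCrit_invHess (ht : t.IsEtaleCrit) :
    t.polyToCrit (t.invHess ht) * t.polyToCrit (derivative (derivative t.P)) = 1 := by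
  have e := congrArg t.polyToCrit ht.choose_spec.choose_spec
  rw [map_add, map_mul, map_mul, t.polyToCrit_eq_zero.2 (dvd_refl (derivative t.P)), map_one] at e
  change _ + t.polyToCrit (t.invHess ht) * _ = 1 at e
  linear_combination e

theorem critLift_aux (ht : t.IsEtaleCrit) (D : Derivation ℤ B B) (f : B[X])
    (hf : (t.polyToCrit : B[X] →+* t.Crit).toIntAlgHom f = 0) :
    (t.polyToCrit : B[X] →+* t.Crit).toIntAlgHom ((coeffDer D -
      (t.invHess ht * coeffDer D (derivative t.P)) • derivative'.restrictScalars ℤ :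
        Derivation ℤ B[X] B[X]) f) = 0 := by
  obtain ⟨g, rfl⟩ := t.polyToCrit_eq_zero.1 hf
  have h0 := t.polyToCrit_eq_zero.2 (dvd_refl (derivative t.P))
  have h1 := t.polyToCrit_invHess ht
  change t.polyToCrit (coeffDer D (derivative t.P * g) -
    (t.invHess ht * coeffDer D (derivative t.P)) * derivative (derivative t.P * g)) = 0
  simp only [Derivation.leibniz, derivative_mul, smul_eq_mul, map_sub, map_add, map_mul, h0]
  linear_combination (-t.polyToCrit (coeffDer D (derivative t.P)) * t.polyToCrit g) * h1

/-- The vector field on `Crit_P` lifting a derivation `D` of `B`; it is induced by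
`D - ((∂P/∂x)_D / (∂²P/∂x²)) ∂/∂x`, where `(∂P/∂x)_D` is obtained by applying `D` to the
coefficients. -/
def critLift (ht : t.IsEtaleCrit) (D : Derivation ℤ B B) : Derivation ℤ t.Crit t.Crit :=
  Derivation.liftOfSurjective (f := (t.polyToCrit : B[X] →+* t.Crit).toIntAlgHom)
    t.polyToCrit_surjective (t.critLift_aux ht D)

theorem critLift_polyToCrit (ht : t.IsEtaleCrit) (D : Derivation ℤ B B) (f : B[X]) :
    t.critLift ht D (t.polyToCrit f) = t.polyToCrit (coeffDer D f -
      t.invHess ht * coeffDer D (derivative t.P) * derivative f) :=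
  Derivation.liftOfSurjective_apply (f := (t.polyToCrit : B[X] →+* t.Crit).toIntAlgHom) _
    (t.critLift_aux ht D) f

/-- The connection of `ℒ = ν_* (𝒫^h restricted to Crit_P)` along a derivation `D` of `B`. -/
def nablaCrit (ht : t.IsEtaleCrit) (D : Derivation ℤ B B) : t.Crit →ₗ[ℤ] t.Crit :=
  (t.critLift ht D).toLinearMap + LinearMap.mulLeft ℤ (algebraMap B t.Crit t.h *
    (t.toCrit t.invP * t.critLift ht D (t.polyToCrit t.P)))

/-- The relative de Rham cohomology `H¹_{dR}(U / B, 𝒫^h)`; the class of `f` is that of `f dx`. -/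
abbrev H1U : Type _ := t.F ⧸ LinearMap.range (t.nabla t.ddx)

/-- The Cartier map on 1-forms, `f dx ↦ -((∇_{∂/∂x})^{p-1} f)` restricted to `Crit_P`. -/
def cartier (p : ℕ) : t.F →ₗ[B] t.Crit :=
  -(t.toCrit.toLinearMap ∘ₗ (t.nabla t.ddx) ^ (p - 1))

section BaseChange

variable {B' : Type*} [CommRing B']

theorem map_P (φ : B →+* B') : (t.map φ).P = t.P.map φ := by
  simp [P, Polynomial.map_prod, map]

/-- Base change of functions on `U`. -/
def mapF (φ : B →+* B') : t.F →+* (t.map φ).F :=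
  IsLocalization.Away.lift t.P (g := (t.map φ).ofPoly.comp (mapRingHom φ)) (by
    rw [RingHom.comp_apply, coe_mapRingHom, ← map_P]
    exact IsLocalization.Away.algebraMap_isUnit _)

theorem mapF_ofPoly (φ : B →+* B') (f : B[X]) :
    t.mapF φ (t.ofPoly f) = (t.map φ).ofPoly (f.map φ) :=
  IsLocalization.Away.lift_eq _ _ _

theorem mapF_smul (φ : B →+* B') (b : B) (f : t.F) : t.mapF φ (b • f) = φ b • t.mapF φ f := by
  rw [Algebra.smul_def, map_mul, algebraMap_eq, mapF_ofPoly, Polynomial.map_C, ← algebraMap_eq,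
    Algebra.smul_def]

theorem mapF_ddx (φ : B →+* B') (f : t.F) :
    t.mapF φ (t.ddx f) = (t.map φ).ddx (t.mapF φ f) := by
  refine leibniz_ext (Submonoid.powers t.P) (t.mapF φ) (fun f => t.mapF φ (t.ddx f))
    (fun f => (t.map φ).ddx (t.mapF φ f)) ?_ ?_ ?_ f
  · intro x y
    simp only [Derivation.leibniz, smul_eq_mul, map_add, map_mul]
  · intro x y
    simp only [Derivation.leibniz, smul_eq_mul, map_mul]
  · intro a
    change t.mapF φ (t.ddx (t.ofPoly a)) = (t.map φ).ddx (t.mapF φ (t.ofPoly a))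
    rw [ddx_ofPoly, mapF_ofPoly, mapF_ofPoly, ddx_ofPoly, derivative_map]

theorem mapF_invP (φ : B →+* B') : t.mapF φ t.invP = (t.map φ).invP := by
  have h := congrArg (t.mapF φ) t.P_mul_invP
  rw [map_mul, map_one, mapF_ofPoly, ← map_P] at h
  linear_combination (t.map φ).invP * h - t.mapF φ t.invP * (t.map φ).P_mul_invP

theorem mapF_nabla (φ : B →+* B') (f : t.F) :
    t.mapF φ (t.nabla t.ddx f) = (t.map φ).nabla (t.map φ).ddx (t.mapF φ f) := by
  rw [nabla_apply, nabla_apply, map_add, map_mul, map_mul, map_mul, mapF_invP, mapF_ddx, mapF_ddx,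
    algebraMap_eq, algebraMap_eq, mapF_ofPoly, mapF_ofPoly, Polynomial.map_C, map_P]
  rfl

variable [Algebra B B']

/-- The restriction map from the base change of `E` along `B → B'` to the relative de Rham
cohomology of `U` over `B'`: the class of a cocycle `(ω₀, ω_∞, g)` goes to that of `ω₀ dx`. -/
def restrictU : B' ⊗[B] t.E →ₗ[B'] (t.map (algebraMap B B')).H1U :=
  letI : Module B (t.map (algebraMap B B')).H1U := Module.compHom _ (algebraMap B B')
  haveI : IsScalarTower B B' (t.map (algebraMap B B')).H1U :=
    ⟨fun b b' x => by rw [Algebra.smul_def, mul_smul]; rfl⟩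
  LinearMap.liftBaseChange B' (Submodule.liftQ _
    ({ toFun := fun c => Submodule.Quotient.mk (t.mapF (algebraMap B B') c.1.1)
       map_add' := fun c d => by
        rw [← Submodule.Quotient.mk_add, ← map_add]; rfl
       map_smul' := fun b c => by
        change Submodule.Quotient.mk (t.mapF _ (b • c.1.1)) = _
        rw [mapF_smul]; rfl } : t.Z1 →ₗ[B] (t.map (algebraMap B B')).H1U) (by
    rintro ⟨c, hc⟩ h
    obtain ⟨⟨a, b⟩, -, rfl⟩ := h
    change Submodule.Quotient.mk (t.mapF _ (t.nabla t.ddx a)) = _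
    rw [mapF_nabla]
    exact (Submodule.Quotient.mk_eq_zero _).2 ⟨_, rfl⟩))

theorem restrictU_tmul (b : B') (c : t.Z1) :
    t.restrictU (b ⊗ₜ Submodule.Quotient.mk c) =
      b • Submodule.Quotient.mk (t.mapF (algebraMap B B') c.1.1) := rfl

/-- The base change to `B'` of the Gauss–Manin connection on `E`, along a derivation `D'` of `B'`
extending `D`: `b ⊗ e ↦ D' b ⊗ e + b ⊗ ∇ e`. -/
def gaussManinBaseChange (D : Derivation ℤ B B) (hD : D t.h = 0) (D' : Derivation ℤ B' B')
    (hD' : ∀ b, D' (algebraMap B B' b) = algebraMap B B' (D b)) :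
    B' ⊗[B] t.E →+ B' ⊗[B] t.E :=
  TensorProduct.liftAddHom
    { toFun := fun b =>
        { toFun := fun e => D' b ⊗ₜ e + b ⊗ₜ t.gaussManin D hD e
          map_zero' := by simp
          map_add' := fun e e' => by
            rw [map_add, TensorProduct.tmul_add, TensorProduct.tmul_add]; abel }
      map_zero' := by ext; simp
      map_add' := fun b b' => by
        ext e
        simp only [map_add, TensorProduct.add_tmul, AddMonoidHom.coe_mk, ZeroHom.coe_mk,
          AddMonoidHom.add_apply]
        abel } (by
    intro r b e
    change D' (r • b) ⊗ₜ e + (r • b) ⊗ₜ t.gaussManin D hD e =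
      D' b ⊗ₜ (r • e) + b ⊗ₜ t.gaussManin D hD (r • e)
    have h : D' (r • b) = r • D' b + D r • b := by
      simp only [Algebra.smul_def r, Algebra.smul_def (D r), Derivation.leibniz, hD', smul_eq_mul,
        mul_comm b]
    rw [h, gaussManin_smul, TensorProduct.add_tmul, TensorProduct.tmul_add]
    simp only [TensorProduct.smul_tmul]
    abel)

end BaseChange

end Pt

/-- The criterion for étaleness through the discriminant. -/
theorem isEtaleCrit_of_isUnit {n : ℕ} {A B : Type*} [CommRing A] [CommRing B] (t : Pt n A)
    (φ : A →+* B) (h : IsUnit (φ ((n : A) * (derivative t.P).discr))) :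
    (t.map φ).IsEtaleCrit := by
  rw [Pt.IsEtaleCrit, Pt.map_P, derivative_map, derivative_map]
  by_cases hn : (n : A) = 0
  · rw [hn, zero_mul, map_zero, isUnit_zero_iff] at h
    have : Subsingleton B := subsingleton_of_zero_eq_one h
    exact ⟨0, 0, Subsingleton.elim _ _⟩
  have : Nontrivial A := ⟨⟨_, _, hn⟩⟩
  have hu : IsUnit (φ n) := by
    rw [map_mul] at h
    exact isUnit_of_mul_isUnit_left h
  have hmon : t.P.Monic := monic_prod_of_monic _ _ fun i _ => monic_X_sub_C _
  have hdeg : t.P.natDegree = n := by simp [Pt.P, natDegree_prod_of_monic _ _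
    fun i _ => monic_X_sub_C (t.z i)]
  have hn0 : n ≠ 0 := by rintro rfl; simp at hn
  have hc : (derivative t.P).coeff (n - 1) = n := by
    have h1 : t.P.coeff (n - 1 + 1) = 1 := by
      rw [Nat.sub_add_cancel (Nat.pos_of_ne_zero hn0)]
      simpa [hdeg] using hmon.coeff_natDegree
    rw [coeff_derivative, h1, one_mul, ← Nat.cast_succ, Nat.succ_eq_add_one,
      Nat.sub_add_cancel (Nat.pos_of_ne_zero hn0)]
  have hd : (derivative t.P).natDegree = n - 1 := by
    refine le_antisymm ((natDegree_derivative_le _).trans (by rw [hdeg])) ?_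
    exact le_natDegree_of_ne_zero (by rwa [hc])
  have hl : (derivative t.P).leadingCoeff = n := by rw [leadingCoeff, hd, hc]
  by_cases h1 : n - 1 = 0
  · have hf : derivative t.P = C (n : A) := by
      rw [eq_C_of_natDegree_eq_zero (hd.trans h1), ← hc, h1]
    rw [hf, Polynomial.map_C]
    obtain ⟨w, hw⟩ := (isUnit_C.2 hu).exists_left_inv
    exact ⟨w, 0, by rw [hw]; ring⟩
  · obtain ⟨a, b, -, -, hab⟩ := exists_mul_add_mul_eq_C_resultant (derivative t.P)
      (derivative (derivative t.P)) le_rfl (natDegree_derivative_le _) (by left; rwa [hd])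
    rw [resultant_deriv (natDegree_pos_iff_degree_pos.1 (by omega)), hl, mul_assoc] at hab
    have e := congrArg (Polynomial.map φ) hab
    rw [Polynomial.map_add, Polynomial.map_mul, Polynomial.map_mul, Polynomial.map_C] at e
    have hr : IsUnit (φ ((-1) ^ ((derivative t.P).natDegree * ((derivative t.P).natDegree - 1) / 2) *
        ((n : A) * (derivative t.P).discr))) := by
      rw [map_mul]
      exact (((isUnit_one.neg).pow _).map φ).mul h
    obtain ⟨w, hw⟩ := (isUnit_C.2 hr).exists_left_inv
    exact ⟨w * a.map φ, w * b.map φ, by rw [← hw, ← e]; ring⟩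

/-- `ℤ[h, h⁻¹]`. -/
def ZH : Type := Localization.Away (X : ℤ[X])

instance : CommRing ZH := inferInstanceAs (CommRing (Localization.Away (X : ℤ[X])))
instance : Algebra ℤ[X] ZH := inferInstanceAs (Algebra ℤ[X] (Localization.Away (X : ℤ[X])))
instance : IsLocalization.Away (X : ℤ[X]) ZH :=
  inferInstanceAs (IsLocalization.Away (X : ℤ[X]) (Localization.Away (X : ℤ[X])))

/-- `𝔽_p[h, (h ^ p - h)⁻¹]`. -/
def FH (p : ℕ) : Type := Localization.Away (X ^ p - X : (ZMod p)[X])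

section
variable (p : ℕ)

instance : CommRing (FH p) := inferInstanceAs (CommRing (Localization.Away (X ^ p - X : (ZMod p)[X])))
instance : Algebra (ZMod p)[X] (FH p) :=
  inferInstanceAs (Algebra (ZMod p)[X] (Localization.Away (X ^ p - X : (ZMod p)[X])))
instance : IsLocalization.Away (X ^ p - X : (ZMod p)[X]) (FH p) :=
  inferInstanceAs (IsLocalization.Away (X ^ p - X : (ZMod p)[X])
    (Localization.Away (X ^ p - X : (ZMod p)[X])))

/-- The reduction `ℤ[h, h⁻¹] → 𝔽_p[h, (h ^ p - h)⁻¹]`. -/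
def redH [Fact p.Prime] : ZH →+* FH p :=
  IsLocalization.Away.lift (X : ℤ[X])
    (g := (algebraMap (ZMod p)[X] (FH p)).comp (mapRingHom (Int.castRingHom (ZMod p)))) (by
    have h : (X : (ZMod p)[X]) ∣ X ^ p - X :=
      dvd_sub (dvd_pow_self X (Fact.out : p.Prime).ne_zero) dvd_rfl
    rw [RingHom.comp_apply, coe_mapRingHom, map_X]
    exact isUnit_of_dvd_unit (map_dvd _ h) (IsLocalization.Away.algebraMap_isUnit _))

theorem redH_h [Fact p.Prime] :
    redH p (algebraMap ℤ[X] ZH X) = algebraMap (ZMod p)[X] (FH p) X := by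
  refine (IsLocalization.Away.lift_eq _ _ _).trans ?_
  simp

end

section
variable (k : Type*) [CommRing k] (n : ℕ)

/-- The product of all `z i - z j`, `i ≠ j`. -/
def diag : MvPolynomial (Fin n) k :=
  ∏ q ∈ Finset.univ.offDiag, (MvPolynomial.X q.1 - MvPolynomial.X q.2)

/-- `𝒪(S) ⊗ k = k[z i, (z i - z j)⁻¹]`. -/
def OS : Type _ := Localization.Away (diag k n)

instance : CommRing (OS k n) := inferInstanceAs (CommRing (Localization.Away (diag k n)))
instance : Algebra (MvPolynomial (Fin n) k) (OS k n) :=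
  inferInstanceAs (Algebra (MvPolynomial (Fin n) k) (Localization.Away (diag k n)))
instance : Algebra k (OS k n) := inferInstanceAs (Algebra k (Localization.Away (diag k n)))
instance : IsScalarTower k (MvPolynomial (Fin n) k) (OS k n) :=
  inferInstanceAs (IsScalarTower k (MvPolynomial (Fin n) k) (Localization.Away (diag k n)))
instance : IsLocalization.Away (diag k n) (OS k n) :=
  inferInstanceAs (IsLocalization.Away (diag k n) (Localization.Away (diag k n)))
instance : Algebra.FormallyEtale (MvPolynomial (Fin n) k) (OS k n) :=
  inferInstanceAs (Algebra.FormallyEtale (MvPolynomial (Fin n) k) (Localization.Away (diag k n)))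

/-- The vector field `∂/∂z i` on `S`, relative to `k`. -/
def dS (i : Fin n) : Derivation k (OS k n) (OS k n) := extendDer (OS k n) (MvPolynomial.pderiv i)

/-- The universal point of `S`, with a given value of the parameter `h` in `k`. -/
def univPt (h : k) : Pt n (OS k n) where
  z i := algebraMap (MvPolynomial (Fin n) k) (OS k n) (MvPolynomial.X i)
  h := algebraMap k (OS k n) h
  isUnit_sub i j hij := by
    rw [← map_sub]
    refine isUnit_of_dvd_unit (map_dvd _ ?_) (IsLocalization.Away.algebraMap_isUnit (diag k n))
    exact Finset.dvd_prod_of_mem (fun q : Fin n × Fin n =>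
      (MvPolynomial.X q.1 - MvPolynomial.X q.2 : MvPolynomial (Fin n) k))
      (a := (i, j)) (by simpa using hij)

variable {k} {k' : Type*} [CommRing k']

theorem map_diag (f : k →+* k') : MvPolynomial.map f (diag k n) = diag k' n := by
  simp [diag]

/-- `𝒪(S) ⊗ k → 𝒪(S) ⊗ k'`. -/
def mapOS (f : k →+* k') : OS k n →+* OS k' n :=
  IsLocalization.Away.lift (diag k n) (g := (algebraMap _ (OS k' n)).comp (MvPolynomial.map f)) (by
    rw [RingHom.comp_apply, map_diag]
    exact IsLocalization.Away.algebraMap_isUnit _)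

theorem mapOS_algebraMap (f : k →+* k') (a : MvPolynomial (Fin n) k) :
    mapOS n f (algebraMap _ _ a) = algebraMap _ (OS k' n) (MvPolynomial.map f a) :=
  IsLocalization.Away.lift_eq _ _ _

theorem mapOS_algebraMap' (f : k →+* k') (a : k) :
    mapOS n f (algebraMap k (OS k n) a) = algebraMap k' (OS k' n) (f a) := by
  rw [IsScalarTower.algebraMap_apply k (MvPolynomial (Fin n) k) (OS k n), mapOS_algebraMap,
    IsScalarTower.algebraMap_apply k' (MvPolynomial (Fin n) k') (OS k' n)]
  simp

theorem mapOS_dS (f : k →+* k') (i : Fin n) (a : OS k n) :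
    mapOS n f (dS k n i a) = dS k' n i (mapOS n f a) := by
  refine leibniz_ext (Submonoid.powers (diag k n)) (mapOS n f) (fun a => mapOS n f (dS k n i a))
    (fun a => dS k' n i (mapOS n f a)) ?_ ?_ ?_ a
  · intro x y
    simp only [Derivation.leibniz, smul_eq_mul, map_add, map_mul]
  · intro x y
    simp only [Derivation.leibniz, smul_eq_mul, map_mul]
  · intro a
    simp only [dS, extendDer_algebraMap, mapOS_algebraMap]
    rw [MvPolynomial.pderiv_map]

end

section
variable (n p : ℕ)

/-- `𝔒 = 𝒪(S)[h, h⁻¹]`. -/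
abbrev O : Type := OS ZH n

/-- The universal family over `S`, with parameter `h`. -/
def family : Pt n (O n) := univPt ZH n (algebraMap ℤ[X] ZH X)

/-- The reduction of the universal family to `𝔽_p[h, (h ^ p - h)⁻¹]`. -/
def familyMod : Pt n (OS (FH p) n) := univPt (FH p) n (algebraMap (ZMod p)[X] (FH p) X)

/-- The equation `n * Disc(∂P/∂x)` of the complement of `S°` in `S`. -/
def discCrit : OS (FH p) n := (n : OS (FH p) n) * (derivative (familyMod n p).P).discr

/-- `𝔒^♭ = 𝒪(S°) ⊗ 𝔽_p[h, (h ^ p - h)⁻¹]`. -/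
def OFlat : Type := Localization.Away (discCrit n p)

instance : CommRing (OFlat n p) := inferInstanceAs (CommRing (Localization.Away (discCrit n p)))
instance : Algebra (OS (FH p) n) (OFlat n p) :=
  inferInstanceAs (Algebra (OS (FH p) n) (Localization.Away (discCrit n p)))
instance : IsLocalization.Away (discCrit n p) (OFlat n p) :=
  inferInstanceAs (IsLocalization.Away (discCrit n p) (Localization.Away (discCrit n p)))
instance : Algebra.FormallyEtale (OS (FH p) n) (OFlat n p) :=
  inferInstanceAs (Algebra.FormallyEtale (OS (FH p) n) (Localization.Away (discCrit n p)))

/-- The vector field `∂/∂z i` on `S`. -/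
def dO (i : Fin n) : Derivation ℤ (O n) (O n) := (dS ZH n i).restrictScalars ℤ

/-- The vector field `∂/∂z i` on the reduction of `S°`. -/
def dOFlat (i : Fin n) : Derivation ℤ (OFlat n p) (OFlat n p) :=
  extendDer (OFlat n p) ((dS (FH p) n i).restrictScalars ℤ)

theorem dO_h (i : Fin n) : dO n i (family n).h = 0 := (dS ZH n i).map_algebraMap _

variable [Fact p.Prime]

/-- The canonical map `𝔒 → 𝔒^♭`. -/
instance : Algebra (O n) (OFlat n p) :=
  ((algebraMap (OS (FH p) n) (OFlat n p)).comp (mapOS n (redH p))).toAlgebra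

theorem dOFlat_algebraMap (i : Fin n) (a : O n) :
    dOFlat n p i (algebraMap (O n) (OFlat n p) a) = algebraMap (O n) (OFlat n p) (dO n i a) := by
  change extendDer (OFlat n p) _ (algebraMap (OS (FH p) n) (OFlat n p) (mapOS n (redH p) a)) =
    algebraMap (OS (FH p) n) (OFlat n p) (mapOS n (redH p) (dS ZH n i a))
  rw [extendDer_algebraMap, mapOS_dS]
  rfl

/-- The restriction of the universal family to the reduction of `S°`. -/
abbrev familyFlat : Pt n (OFlat n p) := (family n).map (algebraMap (O n) (OFlat n p))

theorem isEtaleCrit_familyFlat : (familyFlat n p).IsEtaleCrit := by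
  have h : familyFlat n p = (familyMod n p).map (algebraMap (OS (FH p) n) (OFlat n p)) := by
    change Pt.mk _ _ _ = Pt.mk _ _ _
    congr 1
    · funext i
      change algebraMap (OS (FH p) n) (OFlat n p) (mapOS n (redH p) (algebraMap _ _ _)) = _
      rw [mapOS_algebraMap, MvPolynomial.map_X]
      rfl
    · change algebraMap (OS (FH p) n) (OFlat n p) (mapOS n (redH p) (algebraMap _ _ _)) = _
      rw [mapOS_algebraMap', redH_h]
      rfl
  rw [h]
  exact isEtaleCrit_of_isUnit _ _ (IsLocalization.Away.algebraMap_isUnit (discCrit n p))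

/-- The restriction of `E^♭ = E ⊗ 𝔽_p[h, (h ^ p - h)⁻¹]` to `S°`. -/
abbrev EFlat : Type := OFlat n p ⊗[O n] (family n).E

/-- The Gauss–Manin connection of `E^♭` over `S°`, along `∂/∂z i`. -/
def nablaE (i : Fin n) : EFlat n p →+ EFlat n p :=
  (family n).gaussManinBaseChange (dO n i) (dO_h n i) (dOFlat n p i) (dOFlat_algebraMap n p i)

/-- The module `ℒ ⊗ 𝔽_p[h, (h ^ p - h)⁻¹]` over `S°`, where `ℒ = ν_* (𝒫^h restricted to Crit_P°)`. -/
abbrev LFlat : Type := (familyFlat n p).Crit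

/-- The connection of `ℒ ⊗ 𝔽_p[h, (h ^ p - h)⁻¹]`, along `∂/∂z i`. -/
def nablaL (i : Fin n) : LFlat n p →ₗ[ℤ] LFlat n p :=
  (familyFlat n p).nablaCrit (isEtaleCrit_familyFlat n p) (dOFlat n p i)

end
end

end KZ

/-! In characteristic `p` the `p`-curvature of a rank-one connection is additive in the connection
form (`conn_add_pow_prime_mul`), and for `d + h dy/y` it is `h(h-1)⋯(h-p+1) y^{-p}`
(`conn_pow_one`). As `dP/P` is the sum of the `dx/(x - z_i)`, the operator `∇^p` on `U` is
multiplication by `(h^p - h)(P'/P)^p`. This vanishes where `P' = 0`, so the Cartier map kills exact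
forms.

Horizontality has the same source. On the critical locus `∇` along `x` agrees with `∂/∂x`, so `∂/∂x`
of `∇^{p-1} f` restricts to zero there. The vector field on the critical locus differs from the lift
of `∂/∂z_i` fixing `x` by a multiple of `∂/∂x`, which therefore contributes nothing; flatness of `∇`
does the rest (`cartier_nabla_lift`, `restrictU_gaussManinBaseChange`).

Bijectivity is a count of generators. The image of the Cartier map is stable under multiplication by
`x^p`, which generates the functions on the étale critical locus (`adjoin_pow_eq_top`), so it is an
ideal; commuting `∇` with `x` shows that it contains the unit `(p-1)!` (`factorial_mem_span_conn`).
Restriction to `U` is onto because poles at the `z_i` and at infinity can be lowered modulo exact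
forms, the factors `h - k` and `nh + k` being units (`exactLog_eq_top`). Finally `E` is generated by
the forms `x^j dx/P` with `j < n`, and the relation `∇ 1 = h dP/P` eliminates one of them
(`span_baseChange_logClass`). The composite is thus a surjection from a module with `n - 1`
generators onto a free module of rank `n - 1`, hence bijective. -/

namespace KZ

noncomputable section

/-! ### Rank-one connections and their `p`-th powers -/

section Connections

variable {R A : Type*} [CommRing R] [CommRing A] [Algebra R A]

/-- The connection `f ↦ δ f + a f`. -/
def conn (δ : Derivation R A A) (a : A) : A →ₗ[R] A := δ.toLinearMap + LinearMap.mulLeft R a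

theorem conn_apply (δ : Derivation R A A) (a f : A) : conn δ a f = δ f + a * f := rfl

/-- On `A ⊗ A` the operators `T = ∇_a ⊗ 1` and `U = 1 ⊗ ∇_b` commute, so `(T + U)^p = T^p + U^p`
modulo `p`. By the Leibniz rule, multiplication `A ⊗ A → A` intertwines `T + U` with the connection
of form `a + b`. -/
theorem conn_add_pow_prime_mul {p : ℕ} (hp : p.Prime) (hpA : (p : A) = 0) (δ : Derivation R A A)
    (a b f g : A) :
    (conn δ (a + b) ^ p) (f * g) = (conn δ a ^ p) f * g + f * (conn δ b ^ p) g := by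
  let T : Module.End R (A ⊗[R] A) := (conn δ a).rTensor A
  let U : Module.End R (A ⊗[R] A) := (conn δ b).lTensor A
  have hTU : Commute T U :=
    (LinearMap.rTensor_comp_lTensor _ (conn δ a) (conn δ b)).trans
      (LinearMap.lTensor_comp_rTensor _ (conn δ a) (conn δ b)).symm
  have hμ : ∀ (k : ℕ) (x : A ⊗[R] A), LinearMap.mul' R A (((T + U) ^ k) x) =
      (conn δ (a + b) ^ k) (LinearMap.mul' R A x) := by
    intro k
    induction k with
    | zero => intro x; simp
    | succ k ih =>
      intro x
      rw [pow_succ, pow_succ, Module.End.mul_apply, Module.End.mul_apply, ih]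
      congr 1
      induction x with
      | zero => simp
      | add x y hx hy => simp only [map_add, hx, hy]
      | tmul x y =>
        simp only [T, U, LinearMap.add_apply, LinearMap.rTensor_tmul, LinearMap.lTensor_tmul,
          map_add, LinearMap.mul'_apply, conn_apply, Derivation.leibniz, smul_eq_mul]
        ring
  obtain ⟨r, hr⟩ := hTU.exists_add_pow_prime_eq hp
  have h := hμ p (f ⊗ₜ g)
  have h0 : ∀ x : A ⊗[R] A, (p : Module.End R (A ⊗[R] A)) x = 0 := by
    intro x
    rw [Module.End.natCast_apply, ← Nat.cast_smul_eq_nsmul A, hpA, zero_smul]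
  have hT : ∀ (k : ℕ), (T ^ k) (f ⊗ₜ g) = ((conn δ a ^ k) f) ⊗ₜ g := by
    intro k
    rw [LinearMap.rTensor_pow, LinearMap.rTensor_tmul]
  have hU : ∀ (k : ℕ), (U ^ k) (f ⊗ₜ g) = f ⊗ₜ ((conn δ b ^ k) g) := by
    intro k
    rw [LinearMap.lTensor_pow, LinearMap.lTensor_tmul]
  rw [hr, mul_assoc, mul_assoc, LinearMap.add_apply, LinearMap.add_apply, Module.End.mul_apply, h0, hT, hU] at h
  simpa using h.symm

theorem conn_zero (δ : Derivation R A A) : conn δ 0 = δ.toLinearMap := by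
  simp [conn]

/-- Additivity of the `p`-curvature, obtained from the tensor product formula at `f = g = 1`. -/
theorem conn_sum_pow_prime_one {p : ℕ} (hp : p.Prime) (hpA : (p : A) = 0) (δ : Derivation R A A)
    {ι : Type*} (s : Finset ι) (a : ι → A) :
    (conn δ (∑ i ∈ s, a i) ^ p) 1 = ∑ i ∈ s, (conn δ (a i) ^ p) 1 := by
  classical
  induction s using Finset.induction_on with
  | empty =>
    obtain ⟨k, rfl⟩ := Nat.exists_eq_succ_of_ne_zero hp.ne_zero
    rw [Finset.sum_empty, Finset.sum_empty, pow_succ, Module.End.mul_apply, conn_zero]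
    simp
  | insert i s hi ih =>
    rw [Finset.sum_insert hi, Finset.sum_insert hi, ← ih]
    simpa using conn_add_pow_prime_mul hp hpA δ (a i) (∑ i ∈ s, a i) 1 1

/-- For a coordinate `y`, the iterates of `d + h dy / y` on `1`. -/
theorem conn_pow_one (δ : Derivation R A A) {y w h : A} (hy : y * w = 1)
    (hδ : δ y = 1) (hh : δ h = 0) (k : ℕ) :
    (conn δ (h * w) ^ k) 1 = (∏ j ∈ Finset.range k, (h - j)) * w ^ k := by
  have hw : δ w = - w ^ 2 := by
    have e := congrArg δ hy
    rw [Derivation.leibniz, Derivation.map_one_eq_zero, hδ, smul_eq_mul, smul_eq_mul] at e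
    linear_combination w * e - δ w * hy
  induction k with
  | zero => simp
  | succ k ih =>
    have hc : δ (∏ j ∈ Finset.range k, (h - j)) = 0 := by
      clear ih
      induction k with
      | zero => simp
      | succ k ih =>
        rw [Finset.prod_range_succ, Derivation.leibniz, ih, map_sub, hh, Derivation.map_natCast]
        simp
    rw [pow_succ', Module.End.mul_apply, ih, conn_apply, Derivation.leibniz, hc,
      Derivation.leibniz_pow, hw, Finset.prod_range_succ]
    rcases k with _ | k
    · simp
    · simp only [smul_eq_mul, nsmul_eq_mul, Nat.add_sub_cancel]
      push_cast
      ring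

/-- Every summand has the same factor `∏ (h - j)`, and Frobenius collects the powers `w i ^ p` into
the `p`-th power of the sum. -/
theorem conn_sum_pow_prime_one_eq {p : ℕ} (hp : p.Prime) (hpA : (p : A) = 0)
    (δ : Derivation R A A) {ι : Type*} (s : Finset ι) (y w : ι → A) (h : A)
    (hy : ∀ i, y i * w i = 1) (hδ : ∀ i, δ (y i) = 1) (hh : δ h = 0) :
    (conn δ (h * ∑ i ∈ s, w i) ^ p) 1 =
      (∏ j ∈ Finset.range p, (h - j)) * (∑ i ∈ s, w i) ^ p := by
  classical
  have hsum : (∑ i ∈ s, w i) ^ p = ∑ i ∈ s, w i ^ p := by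
    induction s using Finset.induction_on with
    | empty => simp [hp.ne_zero]
    | insert i s hi ih =>
      obtain ⟨r, hr⟩ := exists_add_pow_prime_eq hp (w i) (∑ i ∈ s, w i)
      rw [Finset.sum_insert hi, Finset.sum_insert hi, hr, ih, hpA]
      ring
  rw [Finset.mul_sum, conn_sum_pow_prime_one hp hpA, hsum, Finset.mul_sum]
  exact Finset.sum_congr rfl fun i _ => conn_pow_one δ (hy i) (hδ i) hh p

theorem conn_mul_of_eq_zero (δ : Derivation R A A) (a : A) {g : A} (hg : δ g = 0) (k : ℕ) (f : A) :
    (conn δ a ^ k) (g * f) = g * (conn δ a ^ k) f := by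
  induction k generalizing f with
  | zero => simp
  | succ k ih =>
    rw [pow_succ, Module.End.mul_apply, Module.End.mul_apply, ← ih]
    congr 1
    rw [conn_apply, conn_apply, Derivation.leibniz, hg, smul_eq_mul, smul_eq_mul]
    ring

/-- The Heisenberg relation `[∇, x] = 1`, iterated. -/
theorem conn_pow_coord_mul (δ : Derivation R A A) (a : A) {x : A} (hx : δ x = 1) (k : ℕ) (f : A) :
    (conn δ a ^ (k + 1)) (x * f) =
      x * (conn δ a ^ (k + 1)) f + (k + 1 : ℕ) * (conn δ a ^ k) f := by
  induction k generalizing f with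
  | zero => simp [conn_apply, hx]; ring
  | succ k ih =>
    rw [pow_succ', Module.End.mul_apply, ih, Module.End.mul_apply]
    have e : (conn δ a ^ (k + 1)) f = conn δ a ((conn δ a ^ k) f) := by
      rw [pow_succ', Module.End.mul_apply]
    rw [conn_apply] at e
    simp only [conn_apply, map_add, Derivation.leibniz, hx, smul_eq_mul, Derivation.map_natCast]
    push_cast
    linear_combination -((k : A) + 1) * e

/-- The ideal generated by the values of `φ ∘ ∇ ^ k` contains `k!`. -/
theorem factorial_mem_span_conn (δ : Derivation R A A) (a : A) {x : A} (hx : δ x = 1)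
    {C : Type*} [CommRing C] (φ : A →+* C) (k : ℕ) :
    (k.factorial : C) ∈ Ideal.span (Set.range fun f => φ ((conn δ a ^ k) f)) := by
  -- The induction needs every `f`, not only `f = 1`: the ideal at stage `k` is compared with the
  -- next one on all its generators.
  suffices h : ∀ f, (k.factorial : C) * φ f ∈
      Ideal.span (Set.range fun f => φ ((conn δ a ^ k) f)) by simpa using h 1
  induction k with
  | zero => exact fun f => Ideal.subset_span ⟨f, by simp⟩
  | succ k ih =>
    intro f
    have hle : ∀ c ∈ Ideal.span (Set.range fun f => φ ((conn δ a ^ k) f)), ((k + 1 : ℕ) : C) * c ∈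
        Ideal.span (Set.range fun f => φ ((conn δ a ^ (k + 1)) f)) := by
      intro c hc
      induction hc using Submodule.span_induction with
      | mem c hc =>
        obtain ⟨f, rfl⟩ := hc
        -- The commutator writes `(k + 1) φ(∇^k f)` as `φ(∇^{k+1}(x f)) - φ(x) φ(∇^{k+1} f)`, a
        -- member of the next ideal.
        have e := congrArg φ (conn_pow_coord_mul δ a hx k f)
        rw [map_add, map_mul φ x, map_mul φ (_ : A), map_natCast, ← sub_eq_iff_eq_add'] at e
        simp only
        rw [← e]
        exact sub_mem (Ideal.subset_span ⟨_, rfl⟩)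
          (Ideal.mul_mem_left _ _ (Ideal.subset_span ⟨_, rfl⟩))
      | zero => simp
      | add c d _ _ hc hd => rw [mul_add]; exact add_mem hc hd
      | smul r c _ hc => rw [smul_eq_mul, mul_left_comm]; exact Ideal.mul_mem_left _ _ hc
    have := hle _ (ih f)
    rwa [← mul_assoc, ← Nat.cast_mul, ← Nat.factorial_succ] at this

end Connections

/-! ### Generation by `p`-th powers -/

/-- An element `y` generating a finite algebra and a simple root of `Q` lies in the subalgebra
generated by `y ^ p`, in characteristic `p`. -/
theorem adjoin_pow_eq_top {B A : Type*} [CommRing B] [CommRing A] [Algebra B A] [Module.Finite B A]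
    {p : ℕ} (hp : p.Prime) (hpB : (p : B) = 0) (y : A) (hy : Algebra.adjoin B {y} = ⊤) (Q : B[X])
    (h0 : aeval y Q = 0) (h1 : IsUnit (aeval y (derivative Q))) :
    Algebra.adjoin B {y ^ p} = ⊤ := by
  set A₀ := Algebra.adjoin B {y ^ p}
  have : Module.Finite A₀ A := Module.Finite.of_restrictScalars_finite B A₀ A
  suffices hs : Function.Surjective (algebraMap A₀ A) by
    rw [eq_top_iff]
    intro a _
    obtain ⟨b, rfl⟩ := hs a
    exact b.2
  -- For a finite extension surjectivity amounts to being an epimorphism, that is, to the two maps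
  -- `A → A ⊗[A₀] A` being equal. It suffices to compare them on `y`.
  rw [← Algebra.isEpi_iff_surjective_algebraMap_of_finite, Algebra.isEpi_iff_forall_one_tmul_eq]
  let ι₁ : A →ₐ[B] A ⊗[A₀] A :=
    (Algebra.TensorProduct.includeLeft : A →ₐ[A₀] A ⊗[A₀] A).restrictScalars B
  let ι₂ : A →ₐ[B] A ⊗[A₀] A :=
    (Algebra.TensorProduct.includeRight : A →ₐ[A₀] A ⊗[A₀] A).restrictScalars B
  suffices hι : ι₂ = ι₁ from fun a => DFunLike.congr_fun hι a
  refine AlgHom.ext_of_adjoin_eq_top hy ?_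
  rintro _ ⟨⟩
  have hpow : ι₂ y ^ p = ι₁ y ^ p := by
    rw [← map_pow, ← map_pow]
    have e := ((Algebra.TensorProduct.includeRight : A →ₐ[A₀] A ⊗[A₀] A).commutes
      ⟨y ^ p, Algebra.subset_adjoin rfl⟩).trans
      ((Algebra.TensorProduct.includeLeft : A →ₐ[A₀] A ⊗[A₀] A).commutes
      ⟨y ^ p, Algebra.subset_adjoin rfl⟩).symm
    exact e
  have hpW : (p : A ⊗[A₀] A) = 0 := by
    rw [← map_natCast (algebraMap B (A ⊗[A₀] A)), hpB, map_zero]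
  have hnil : (ι₂ y - ι₁ y) ^ p = 0 := by
    obtain ⟨r, hr⟩ := exists_add_pow_prime_eq hp (ι₂ y - ι₁ y) (ι₁ y)
    rw [sub_add_cancel, hpow, hpW] at hr
    linear_combination -hr
  -- Both images of `y` are roots of `Q` and their difference `ε` is nilpotent. Taylor expansion
  -- gives `0 = (Q'(ι₁ y) + k ε) ε`, where the first factor is a unit plus a nilpotent.
  obtain ⟨k, hk⟩ := binomExpansion (Q.map (algebraMap B (A ⊗[A₀] A))) (ι₁ y) (ι₂ y - ι₁ y)
  rw [add_sub_cancel, derivative_map, eval_map_algebraMap, eval_map_algebraMap,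
    eval_map_algebraMap, aeval_algHom_apply, aeval_algHom_apply, aeval_algHom_apply, h0, map_zero,
    map_zero, zero_add] at hk
  have hu : IsUnit (ι₁ (aeval y (derivative Q)) + k * (ι₂ y - ι₁ y)) := by
    refine IsNilpotent.isUnit_add_left_of_commute ?_ (h1.map ι₁) (Commute.all _ _)
    exact (Commute.all _ _).isNilpotent_mul_left ⟨p, hnil⟩
  rw [← sub_eq_zero]
  refine hu.mul_left_cancel ?_
  linear_combination -hk
-- The Cartier map: exact forms and horizontality
namespace Pt

variable {n : ℕ} {B : Type*} [CommRing B] (t : Pt n B)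

theorem nabla_ddx_eq_conn :
    t.nabla t.ddx =
      conn t.ddx (algebraMap B t.F t.h * (t.invP * t.ofPoly (derivative t.P))) := by
  rw [← ddx_ofPoly]
  rfl

theorem natCast_F_eq_zero {p : ℕ} (hpB : (p : B) = 0) : (p : t.F) = 0 := by
  rw [← map_natCast (algebraMap B t.F), hpB, map_zero]

/-- The function `1 / (x - z i)` on `U`. -/
def invLin (i : Fin n) : t.F :=
  t.invP * t.ofPoly (∏ k ∈ Finset.univ.erase i, (X - C (t.z k)))

theorem mul_invLin (i : Fin n) : t.ofPoly (X - C (t.z i)) * t.invLin i = 1 := by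
  rw [invLin, mul_left_comm, ← map_mul,
    Finset.mul_prod_erase _ (fun k => X - C (t.z k)) (Finset.mem_univ i), mul_comm]
  exact t.P_mul_invP

theorem dlog_eq_sum : t.invP * t.ofPoly (derivative t.P) = ∑ i, t.invLin i := by
  rw [P, derivative_prod_finset]
  simp [invLin, Finset.mul_sum]

/-- The `p`-th iterate of a derivation is a derivation in characteristic `p`, so it is determined by
polynomials, on which it is `p!` times a Hasse derivative. -/
theorem ddx_pow_prime {p : ℕ} (hp : p.Prime) (hpB : (p : B) = 0) (f : t.F) :
    (conn t.ddx 0 ^ p) f = 0 := by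
  have hpF := t.natCast_F_eq_zero hpB
  refine leibniz_ext (Submonoid.powers t.P) (RingHom.id t.F) (fun f => (conn t.ddx 0 ^ p) f)
    (fun _ => 0) ?_ (by simp) ?_ f
  · intro x y
    have := conn_add_pow_prime_mul hp hpF t.ddx 0 0 x y
    rw [add_zero] at this
    simp only [this, RingHom.id_apply]
    ring
  · intro a
    have h : ∀ k, (conn t.ddx 0 ^ k) (t.ofPoly a) = t.ofPoly (derivative^[k] a) := by
      intro k
      induction k with
      | zero => simp
      | succ k ih =>
        rw [pow_succ', Module.End.mul_apply, ih, conn_apply, ddx_ofPoly, zero_mul, add_zero,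
          Function.iterate_succ_apply']
    change (conn t.ddx 0 ^ p) (t.ofPoly a) = 0
    obtain ⟨k, hk⟩ := Nat.dvd_factorial hp.pos le_rfl
    have hfac : ((p.factorial : ℕ) : t.F) = 0 := by rw [hk, Nat.cast_mul, hpF, zero_mul]
    rw [h, ← factorial_smul_hasseDeriv, LinearMap.smul_apply, map_nsmul, nsmul_eq_mul, hfac,
      zero_mul]

theorem toCrit_dlog : t.toCrit (t.invP * t.ofPoly (derivative t.P)) = 0 := by
  rw [map_mul, toCrit_ofPoly, t.polyToCrit_eq_zero.2 dvd_rfl, mul_zero]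

/-- The `p`-curvature of `𝒫^h` vanishes on the critical locus. -/
theorem toCrit_nabla_pow_prime {p : ℕ} (hp : p.Prime) (hpB : (p : B) = 0) (f : t.F) :
    t.toCrit ((t.nabla t.ddx ^ p) f) = 0 := by
  have hpF := t.natCast_F_eq_zero hpB
  -- Splitting `f` as `1 * f`, with the whole connection form on the factor `1`, gives `∇^p f = (∇^p
  -- 1) f + ∂^p f`. The last term is zero, and `∇^p 1` is divisible by `(P'/P)^p`.
  have h := conn_add_pow_prime_mul hp hpF t.ddx
    (algebraMap B t.F t.h * (t.invP * t.ofPoly (derivative t.P))) 0 1 f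
  rw [add_zero, one_mul, ← nabla_ddx_eq_conn, t.ddx_pow_prime hp hpB, mul_zero, add_zero,
    nabla_ddx_eq_conn, dlog_eq_sum, conn_sum_pow_prime_one_eq hp hpF t.ddx Finset.univ
      (fun i => t.ofPoly (X - C (t.z i))) t.invLin _ t.mul_invLin (by simp)
      (Derivation.map_algebraMap _ _)] at h
  rw [nabla_ddx_eq_conn, dlog_eq_sum, h, map_mul, map_mul, map_pow, ← dlog_eq_sum, toCrit_dlog,
    zero_pow hp.ne_zero, mul_zero, zero_mul]

theorem cartier_nabla {p : ℕ} (hp : p.Prime) (hpB : (p : B) = 0) (f : t.F) :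
    t.cartier p (t.nabla t.ddx f) = 0 := by
  change - t.toCrit ((t.nabla t.ddx ^ (p - 1)) (t.nabla t.ddx f)) = 0
  rw [← Module.End.mul_apply, ← pow_succ, Nat.sub_add_cancel hp.one_le,
    t.toCrit_nabla_pow_prime hp hpB, neg_zero]

/-- The Cartier map is horizontal. -/
theorem cartier_nabla_lift {p : ℕ} (hp : p.Prime) (hpB : (p : B) = 0) (ht : t.IsEtaleCrit)
    (D : Derivation ℤ B B) (hD : D t.h = 0) (f : t.F) :
    t.cartier p (t.nabla (t.lift D) f) = t.nablaCrit ht D (t.cartier p f) := by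
  -- Flatness of `∇`; this is where `D` must kill `h`.
  have hcomm : ∀ k f, (t.nabla t.ddx ^ k) (t.nabla (t.lift D) f) =
      t.nabla (t.lift D) ((t.nabla t.ddx ^ k) f) := by
    intro k
    induction k with
    | zero => simp
    | succ k ih =>
      intro f
      rw [pow_succ, Module.End.mul_apply, Module.End.mul_apply, ← t.nabla_comm D hD, ih]
  have hcrit : ∀ g, t.critLift ht D (t.toCrit g) = t.toCrit (t.lift D g -
      t.ofPoly (t.invHess ht * coeffDer D (derivative t.P)) * t.ddx g) := by
    refine leibniz_ext (Submonoid.powers t.P) (t.toCrit : t.F →+* t.Crit)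
      (fun g => t.critLift ht D (t.toCrit g)) (fun g => t.toCrit (t.lift D g -
      t.ofPoly (t.invHess ht * coeffDer D (derivative t.P)) * t.ddx g)) ?_ ?_ ?_
    · intro x y
      simp only [map_mul, Derivation.leibniz, smul_eq_mul, RingHom.coe_coe]
    · intro x y
      simp only [Derivation.leibniz, smul_eq_mul, map_add, map_sub, map_mul, RingHom.coe_coe]
      ring
    · intro a
      change t.critLift ht D (t.toCrit (t.ofPoly a)) = t.toCrit (t.lift D (t.ofPoly a) -
        t.ofPoly (t.invHess ht * coeffDer D (derivative t.P)) * t.ddx (t.ofPoly a))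
      rw [toCrit_ofPoly, critLift_polyToCrit, lift_ofPoly, ddx_ofPoly, ← map_mul, ← map_sub,
        toCrit_ofPoly]
  have h0 := t.polyToCrit_eq_zero.2 (dvd_refl (derivative t.P))
  change - t.toCrit ((t.nabla t.ddx ^ (p - 1)) (t.nabla (t.lift D) f)) =
    t.nablaCrit ht D (- t.toCrit ((t.nabla t.ddx ^ (p - 1)) f))
  rw [hcomm, map_neg]
  -- With `g = ∇^{p-1} f`, the vanishing of `∇ g` on the critical locus becomes that of `∂g/∂x`,
  -- because `P' = 0` there. This removes the correction term of `hcrit g`.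
  have hg := t.toCrit_nabla_pow_prime hp hpB f
  rw [← Nat.sub_add_cancel hp.one_le, pow_succ', Module.End.mul_apply] at hg
  generalize (t.nabla t.ddx ^ (p - 1)) f = g at hg
  congr 1
  change t.toCrit (t.nabla (t.lift D) g) = t.critLift ht D (t.toCrit g) + algebraMap B t.Crit t.h *
    (t.toCrit t.invP * t.critLift ht D (t.polyToCrit t.P)) * t.toCrit g
  -- For `P` itself the correction term contains the factor `P'`, so the two lifts of `D` agree on
  -- `P` along the critical locus.
  have e := hcrit (t.ofPoly t.P)
  rw [toCrit_ofPoly, ddx_ofPoly, map_sub, map_mul, toCrit_ofPoly (f := derivative t.P), h0,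
    mul_zero, sub_zero] at e
  rw [nabla_apply, map_add, map_mul, map_mul, ddx_ofPoly, toCrit_dlog, mul_zero, zero_mul,
    add_zero] at hg
  rw [e, hcrit g, map_sub, map_mul, hg, nabla_apply]
  simp only [map_add, map_mul, AlgHom.commutes]
  ring

/-! ### The algebra of the critical locus and surjectivity of the Cartier map -/

theorem monic_P : t.P.Monic := monic_prod_of_monic _ _ fun _ _ => monic_X_sub_C _

theorem natDegree_P [Nontrivial B] : t.P.natDegree = n := by
  simp [P, natDegree_prod_of_monic _ _ fun i _ => monic_X_sub_C (t.z i)]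

theorem coeff_derivative_P (hn : n ≠ 0) : (derivative t.P).coeff (n - 1) = n := by
  nontriviality B
  have h1 : t.P.coeff (n - 1 + 1) = 1 := by
    rw [Nat.sub_add_cancel (Nat.pos_of_ne_zero hn)]
    simpa [t.natDegree_P] using t.monic_P.coeff_natDegree
  rw [coeff_derivative, h1, one_mul, ← Nat.cast_succ, Nat.succ_eq_add_one,
    Nat.sub_add_cancel (Nat.pos_of_ne_zero hn)]

theorem natDegree_derivative_P_le : (derivative t.P).natDegree ≤ n - 1 :=
  (natDegree_derivative_le _).trans (Nat.sub_le_sub_right t.natDegree_P_le 1)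

/-- The polynomial `P'` has degree `n - 1` and unit leading coefficient `n`, so rescaling makes it
monic and the powers of `x` give a basis. -/
theorem exists_critEquiv [Nontrivial B] (hn : IsUnit (n : B)) :
    Nonempty (t.Crit ≃ₗ[B] (Fin (n - 1) → B)) := by
  have hn0 : n ≠ 0 := by rintro rfl; simp at hn
  have hd : (derivative t.P).natDegree = n - 1 := by
    refine le_antisymm t.natDegree_derivative_P_le (le_natDegree_of_ne_zero ?_)
    rw [t.coeff_derivative_P hn0]
    exact hn.ne_zero
  obtain ⟨v, hv⟩ := hn.exists_left_inv
  have hvu : IsUnit v := IsUnit.of_mul_eq_one _ hv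
  have hg : (C v * derivative t.P).Monic := by
    refine monic_C_mul_of_mul_leadingCoeff_eq_one ?_
    rw [leadingCoeff, hd, t.coeff_derivative_P hn0, hv]
  have hI : Ideal.span {C v * derivative t.P} = Ideal.span {derivative t.P} :=
    Ideal.span_singleton_mul_left_unit (isUnit_C.2 hvu) _
  have hdim : (AdjoinRoot.powerBasis' hg).dim = n - 1 := by
    rw [AdjoinRoot.powerBasis'_dim, natDegree_C_mul_of_isUnit hvu, hd]
  exact ⟨((Ideal.quotientEquivAlgOfEq B hI).symm.toLinearEquiv : t.Crit ≃ₗ[B] _) ≪≫ₗ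
    (AdjoinRoot.powerBasis' hg).basis.equivFun ≪≫ₗ
    LinearEquiv.funCongrLeft B B (finCongr hdim.symm)⟩

theorem finite_Crit (hn : IsUnit (n : B)) : Module.Finite B t.Crit := by
  rcases subsingleton_or_nontrivial B with _ | _
  · have := Module.subsingleton B t.Crit
    infer_instance
  · obtain ⟨e⟩ := t.exists_critEquiv hn
    exact Module.Finite.equiv e.symm

/-- Étaleness says that the coordinate `x` is a simple root of `P'` on the critical locus. -/
theorem adjoin_X_pow_eq_top {p : ℕ} (hp : p.Prime) (hpB : (p : B) = 0) (hn : IsUnit (n : B))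
    (ht : t.IsEtaleCrit) : Algebra.adjoin B {t.polyToCrit X ^ p} = ⊤ := by
  have := t.finite_Crit hn
  have hae : ∀ f : B[X], aeval (t.polyToCrit X) f = t.polyToCrit f := fun f => by
    rw [aeval_algHom_apply, aeval_X_left_apply]
  refine adjoin_pow_eq_top hp hpB _ ?_ (derivative t.P) ?_ ?_
  · rw [Algebra.adjoin_singleton_eq_range_aeval, AlgHom.range_eq_top]
    intro a
    obtain ⟨f, rfl⟩ := t.polyToCrit_surjective a
    exact ⟨f, hae f⟩
  · rw [hae, t.polyToCrit_eq_zero]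
  · rw [hae]
    exact IsUnit.of_mul_eq_one_right _ (t.polyToCrit_invHess ht)

/-- The image is an ideal, not merely a `B`-submodule, and it contains the unit `(p-1)!`. -/
theorem cartier_surjective {p : ℕ} (hp : p.Prime) (hpB : (p : B) = 0) (hn : IsUnit (n : B))
    (ht : t.IsEtaleCrit) : Function.Surjective (t.cartier p) := by
  -- Since `x^p` is a constant for `∂/∂x`, multiplication by it commutes with `∇`. As `x^p`
  -- generates the functions on the critical locus, the image absorbs all of them.
  have hX : t.ddx (t.ofPoly X ^ p) = 0 := by
    rw [Derivation.leibniz_pow, ← Nat.cast_smul_eq_nsmul B, hpB, zero_smul]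
  have hmul : ∀ c d : t.Crit, d ∈ LinearMap.range (t.cartier p) →
      c * d ∈ LinearMap.range (t.cartier p) := by
    intro c
    have hc : c ∈ Algebra.adjoin B {t.polyToCrit X ^ p} := by
      rw [t.adjoin_X_pow_eq_top hp hpB hn ht]; trivial
    induction hc using Algebra.adjoin_induction with
    | mem c hc =>
      obtain rfl := hc
      rintro _ ⟨f, rfl⟩
      refine ⟨t.ofPoly X ^ p * f, ?_⟩
      change - t.toCrit ((t.nabla t.ddx ^ (p - 1)) (t.ofPoly X ^ p * f)) =
        t.polyToCrit X ^ p * - t.toCrit ((t.nabla t.ddx ^ (p - 1)) f)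
      rw [nabla_ddx_eq_conn, conn_mul_of_eq_zero _ _ hX, map_mul, map_pow, toCrit_ofPoly]
      ring
    | algebraMap b =>
      intro d hd
      rw [← Algebra.smul_def]
      exact Submodule.smul_mem _ _ hd
    | add c d _ _ hc hd =>
      intro e he
      rw [add_mul]
      exact add_mem (hc e he) (hd e he)
    | mul c d _ _ hc hd =>
      intro e he
      rw [mul_assoc]
      exact hc _ (hd e he)
  have hle : ∀ c ∈ Ideal.span (Set.range fun f => (t.toCrit : t.F →+* t.Crit)
      ((t.nabla t.ddx ^ (p - 1)) f)), c ∈ LinearMap.range (t.cartier p) := by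
    intro c hc
    induction hc using Submodule.span_induction with
    | mem c hc =>
      obtain ⟨f, rfl⟩ := hc
      -- The sign offsets the one in the definition of the Cartier map.
      refine ⟨-f, ?_⟩
      rw [map_neg]
      exact neg_neg _
    | zero => exact zero_mem _
    | add c d _ _ hc hd => exact add_mem hc hd
    | smul r c _ hc => exact hmul _ _ hc
  have hfac := hle _ (by
    rw [nabla_ddx_eq_conn]
    exact factorial_mem_span_conn t.ddx _ (x := t.ofPoly X) (by simp)
      (t.toCrit : t.F →+* t.Crit) (p - 1))
  have hun : IsUnit (((p - 1).factorial : ℕ) : B) := by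
    have hco : IsCoprime ((p - 1).factorial : ℤ) (p : ℤ) := by
      rw [Nat.isCoprime_iff_coprime, Nat.coprime_comm, hp.coprime_iff_not_dvd, hp.dvd_factorial]
      have := hp.one_le
      omega
    obtain ⟨a, b, hab⟩ := hco
    have e := congrArg (Int.cast : ℤ → B) hab
    push_cast at e
    rw [hpB, mul_zero, add_zero] at e
    exact IsUnit.of_mul_eq_one_right _ e
  obtain ⟨v, hv⟩ := hun.exists_left_inv
  intro c
  have h1 := hmul (c * algebraMap B t.Crit v) _ hfac
  rwa [mul_assoc, ← map_natCast (algebraMap B t.Crit), ← map_mul, hv, map_one, mul_one] at h1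

/-! ### Reduction of poles on `U` -/

/-- The coefficient of the logarithmic form `x ^ j dx / P`. -/
def logForm (j : ℕ) : t.F := t.ofPoly (X ^ j) * t.invP

theorem ofPoly_mul_invP_eq_sum {a : B[X]} {m : ℕ} (ha : a.natDegree < m) :
    t.ofPoly a * t.invP = ∑ j ∈ Finset.range m, a.coeff j • t.logForm j := by
  conv_lhs => rw [a.as_sum_range_C_mul_X_pow' ha]
  rw [map_sum, Finset.sum_mul]
  refine Finset.sum_congr rfl fun j _ => ?_
  rw [map_mul, ← algebraMap_eq, mul_assoc, Algebra.smul_def, logForm]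

theorem nabla_ofPoly (a : B[X]) :
    t.nabla t.ddx (t.ofPoly a) =
      t.ofPoly (derivative a * t.P + C t.h * derivative t.P * a) * t.invP := by
  simp only [nabla_apply, ddx_ofPoly, map_add, map_mul, algebraMap_eq]
  linear_combination (- t.ofPoly (derivative a)) * t.P_mul_invP

/-- The factor `h - m` in the term of highest pole order is what must be invertible to lower that
order. -/
theorem nabla_ofPoly_mul_invP_pow (a : B[X]) (m : ℕ) :
    t.nabla t.ddx (t.ofPoly a * t.invP ^ m) = t.ofPoly (derivative a) * t.invP ^ m +
      t.ofPoly (C (t.h - m) * (derivative t.P * a)) * t.invP ^ (m + 1) := by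
  have hm : t.ofPoly (C (m : B)) = (m : t.F) := by simp
  rw [nabla_mul, ddx_ofPoly, nabla_apply, Derivation.leibniz_pow, der_invP, ddx_ofPoly]
  simp only [map_mul, map_sub, hm, algebraMap_eq, smul_eq_mul, nsmul_eq_mul]
  rcases m with _ | m
  · simp
    ring
  · simp only [Nat.add_sub_cancel]
    ring

/-- The span of exact forms and of the logarithmic forms on `ℙ¹`. -/
def exactLog : Submodule B t.F :=
  LinearMap.range (t.nabla t.ddx) ⊔ Submodule.span B (Set.range fun j : Fin n => t.logForm j)

theorem nabla_mem_exactLog (f : t.F) : t.nabla t.ddx f ∈ t.exactLog :=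
  Submodule.mem_sup_left ⟨f, rfl⟩

/-- Lowers the pole at infinity: `∇(x^{k+1})` is `q/P` with `deg q ≤ n + k`, and its coefficient in
degree `n + k` is the unit `nh + k + 1`. Hence `x^{n+k} dx/P` is equivalent to a combination of
lower powers. -/
theorem logForm_mem_exactLog (hn : n ≠ 0) (hh : ∀ k : ℕ, IsUnit (n * t.h + k)) (d : ℕ) :
    t.logForm d ∈ t.exactLog := by
  induction d using Nat.strong_induction_on with
  | _ d ih =>
  rcases lt_or_ge d n with hd | hd
  · exact Submodule.mem_sup_right (Submodule.subset_span ⟨⟨d, hd⟩, rfl⟩)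
  rcases subsingleton_or_nontrivial B with _ | _
  · have := Module.subsingleton B t.F
    rw [Subsingleton.elim (t.logForm d) 0]
    exact zero_mem _
  obtain ⟨k, rfl⟩ := Nat.exists_eq_add_of_le hd
  set q := derivative (X ^ (k + 1)) * t.P + C t.h * derivative t.P * X ^ (k + 1) with hq
  have hq' : q = C ((k + 1 : ℕ) : B) * (X ^ k * t.P) + C t.h * (derivative t.P * X ^ (k + 1)) := by
    rw [hq, derivative_X_pow]
    simp only [Nat.add_sub_cancel]
    ring
  have hdeg : q.natDegree < n + k + 1 := by
    rw [hq']
    have h1 := natDegree_C_mul_le ((k + 1 : ℕ) : B) (X ^ k * t.P)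
    have h2 := natDegree_C_mul_le t.h (derivative t.P * X ^ (k + 1))
    have h3 : (X ^ k * t.P).natDegree ≤ k + n :=
      natDegree_mul_le_of_le (natDegree_X_pow_le k) t.natDegree_P_le
    have h4 : (derivative t.P * X ^ (k + 1)).natDegree ≤ (n - 1) + (k + 1) :=
      natDegree_mul_le_of_le t.natDegree_derivative_P_le (natDegree_X_pow_le _)
    have h5 := natDegree_add_le (C ((k + 1 : ℕ) : B) * (X ^ k * t.P))
      (C t.h * (derivative t.P * X ^ (k + 1)))
    omega
  have hlead : q.coeff (n + k) = n * t.h + (k + 1 : ℕ) := by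
    have h1 : t.P.coeff n = 1 := by
      simpa [t.natDegree_P] using t.monic_P.coeff_natDegree
    have e : n + k = (n - 1) + (k + 1) := by omega
    rw [hq', coeff_add, coeff_C_mul, coeff_C_mul, coeff_X_pow_mul, h1]
    rw [e, coeff_mul_X_pow, t.coeff_derivative_P hn]
    ring
  have hmem := t.nabla_mem_exactLog (t.ofPoly (X ^ (k + 1)))
  rw [nabla_ofPoly, ← hq, t.ofPoly_mul_invP_eq_sum hdeg, Finset.sum_range_succ,
    Submodule.add_mem_iff_right _ (Submodule.sum_mem _ fun j hj =>
      Submodule.smul_mem _ _ (ih j (Finset.mem_range.1 hj))), hlead] at hmem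
  exact (Submodule.smul_mem_iff_of_isUnit _ (hh (k + 1))).1 hmem

/-- Lowers the poles along the `z_i`: with `α P + β P' = 1`, the term `a/P^{m+2}` is, up to lower
pole order, `∇` of `a β / P^{m+1}` divided by the unit `h - (m + 1)`. -/
theorem ofPoly_mul_invP_pow_mem_exactLog (hn : n ≠ 0) (hh : ∀ k : ℕ, IsUnit (n * t.h + k))
    (hh' : ∀ k : ℕ, IsUnit (t.h - k)) (m : ℕ) (a : B[X]) :
    t.ofPoly a * t.invP ^ (m + 1) ∈ t.exactLog := by
  induction m generalizing a with
  | zero =>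
    rw [zero_add, pow_one, t.ofPoly_mul_invP_eq_sum (Nat.lt_succ_self _)]
    exact Submodule.sum_mem _ fun j _ => Submodule.smul_mem _ _ (t.logForm_mem_exactLog hn hh j)
  | succ m ih =>
    obtain ⟨α, β, hαβ⟩ := t.separable_P
    obtain ⟨v, hv⟩ := (hh' (m + 1)).exists_left_inv
    have h1 := t.nabla_mem_exactLog (t.ofPoly (C v * (a * β)) * t.invP ^ (m + 1))
    have h2 : C (t.h - (m + 1 : ℕ)) * (derivative t.P * (C v * (a * β))) = a - a * α * t.P := by
      have hv' : C v * C (t.h - (m + 1 : ℕ)) = 1 := by rw [← C_mul, hv, C_1]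
      linear_combination (derivative t.P * a * β) * hv' + a * hαβ
    rw [nabla_ofPoly_mul_invP_pow, Submodule.add_mem_iff_right _ (ih _), h2] at h1
    have h3 : t.ofPoly (a - a * α * t.P) * t.invP ^ (m + 1 + 1) =
        t.ofPoly a * t.invP ^ (m + 1 + 1) - t.ofPoly (a * α) * t.invP ^ (m + 1) := by
      simp only [map_sub, map_mul]
      linear_combination (- t.ofPoly a * t.ofPoly α * t.invP ^ (m + 1)) * t.P_mul_invP
    rw [h3, Submodule.sub_mem_iff_left _ (ih _)] at h1
    exact h1

theorem exists_eq_ofPoly_mul_invP_pow (f : t.F) :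
    ∃ (m : ℕ) (a : B[X]), f = t.ofPoly a * t.invP ^ m := by
  obtain ⟨⟨a, ⟨_, m, rfl⟩⟩, ha⟩ := IsLocalization.surj (Submonoid.powers t.P) f
  refine ⟨m, a, ?_⟩
  change f * t.ofPoly (t.P ^ m) = t.ofPoly a at ha
  rw [← ha, map_pow, mul_assoc, ← mul_pow, P_mul_invP, one_pow, mul_one]

theorem exactLog_eq_top (hn : n ≠ 0) (hh : ∀ k : ℕ, IsUnit (n * t.h + k))
    (hh' : ∀ k : ℕ, IsUnit (t.h - k)) : t.exactLog = ⊤ := by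
  rw [eq_top_iff]
  intro f _
  obtain ⟨m, a, rfl⟩ := t.exists_eq_ofPoly_mul_invP_pow f
  -- Multiplying numerator and denominator by `P` ensures at least one power of `P` below, which
  -- also covers `m = 0`.
  have := t.ofPoly_mul_invP_pow_mem_exactLog hn hh hh' m (a * t.P)
  have e : t.ofPoly (a * t.P) * t.invP ^ (m + 1) = t.ofPoly a * t.invP ^ m := by
    rw [map_mul]
    linear_combination (t.ofPoly a * t.invP ^ m) * t.P_mul_invP
  rwa [e] at this

/-! ### Generators of `E` -/

theorem logForm_mem_log₀ (j : ℕ) : t.logForm j ∈ t.log₀ := by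
  refine t.mem_reg₀.2 ⟨X ^ j, ?_⟩
  change _ = t.ofPoly t.P * (t.ofPoly (X ^ j) * t.invP)
  rw [mul_left_comm, P_mul_invP, mul_one]

theorem logForm_mem_logInf {j : ℕ} (hj : j < n) : t.logForm j ∈ t.logInf := by
  refine ⟨1, X ^ (j + 1), (natDegree_X_pow_le _).trans (by omega), ?_⟩
  change t.ofPoly t.P ^ 1 * (t.ofPoly X * (t.ofPoly (X ^ j) * t.invP)) = _
  rw [pow_one, pow_succ' X j, map_mul]
  linear_combination (t.ofPoly X * t.ofPoly (X ^ j)) * t.P_mul_invP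

/-- A form with logarithmic poles on both charts, as a cocycle. -/
def globalForm : (t.log₀ ⊓ t.logInf : Submodule B t.F) →ₗ[B] t.E :=
  (t.B1.submoduleOf t.Z1).mkQ ∘ₗ
    LinearMap.codRestrict t.Z1 ((LinearMap.id.prod (LinearMap.id.prod 0)) ∘ₗ
      (t.log₀ ⊓ t.logInf).subtype) (fun f => ⟨f.2.1, f.2.2, by simp⟩)

/-- The class in `E` of the global logarithmic form `x ^ j dx / P`. -/
def logClass (j : Fin n) : t.E :=
  t.globalForm ⟨t.logForm j, t.logForm_mem_log₀ j, t.logForm_mem_logInf j.2⟩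

/-- This is the vanishing of `H¹(ℙ¹, 𝒪)`: the Čech component `g` is a difference of functions
regular on the two charts, so subtracting a coboundary leaves a global logarithmic form. -/
theorem globalForm_surjective : Function.Surjective t.globalForm := by
  intro e
  obtain ⟨⟨⟨ω, ω', g⟩, h₁, h₂, h₃⟩, rfl⟩ := Submodule.Quotient.mk_surjective _ e
  simp only at h₁ h₂ h₃
  obtain ⟨m, a, ha⟩ := t.exists_eq_ofPoly_mul_invP_pow g
  nontriviality B
  have hmon := t.monic_P.pow m
  -- Division with remainder by `P^m` separates the polynomial part of `g` from a part regular at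
  -- infinity.
  set q := t.ofPoly (a /ₘ t.P ^ m)
  set r := t.ofPoly (a %ₘ t.P ^ m) * t.invP ^ m
  have hPm : t.ofPoly t.P ^ m * t.invP ^ m = 1 := by rw [← mul_pow, P_mul_invP, one_pow]
  have hg : g = q + r := by
    rw [ha]
    conv_lhs => rw [← modByMonic_add_div a (t.P ^ m)]
    rw [map_add, map_mul, map_pow]
    linear_combination q * hPm
  have hr : r ∈ t.regInf := by
    refine ⟨m, a %ₘ t.P ^ m, ?_, ?_⟩
    · refine (natDegree_modByMonic_le _ hmon).trans (natDegree_pow_le.trans ?_)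
      rw [mul_comm]
      exact Nat.mul_le_mul_right m t.natDegree_P_le
    · rw [mul_left_comm, hPm, mul_one]
  have hq : q ∈ t.reg₀ := ⟨_, rfl⟩
  have hB : t.d0 (q, -r) ∈ t.B1 := ⟨(q, -r), ⟨hq, neg_mem hr⟩, rfl⟩
  obtain ⟨k₁, k₂, -⟩ := t.B1_le_Z1 hB
  have hω : ω - t.nabla t.ddx q = ω' - t.nabla t.ddx (-r) := by
    rw [hg, map_add] at h₃
    rw [map_neg]
    linear_combination h₃
  refine ⟨⟨ω - t.nabla t.ddx q, sub_mem h₁ k₁, ?_⟩, ?_⟩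
  · rw [hω]
    exact sub_mem h₂ k₂
  · refine ((Submodule.Quotient.eq _).2 ?_).symm
    change ((ω, ω', g) : t.F × t.F × t.F) - (ω - t.nabla t.ddx q, ω - t.nabla t.ddx q, 0) ∈ t.B1
    convert hB using 1
    refine Prod.ext ?_ (Prod.ext ?_ ?_)
    · change ω - (ω - t.nabla t.ddx q) = t.nabla t.ddx q
      ring
    · change ω' - (ω - t.nabla t.ddx q) = t.nabla t.ddx (-r)
      rw [hω]
      ring
    · change g - 0 = q - -r
      rw [hg]
      ring

/-- Here `a = P f` is a polynomial, and the condition at infinity bounds its degree: `P^m x a = P b`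
with `deg b ≤ nm` forces `deg a < n` when `a ≠ 0`. -/
theorem eq_sum_logForm {f : t.F} (h₀ : f ∈ t.log₀) (h₁ : f ∈ t.logInf) :
    ∃ a : B[X], f = ∑ j : Fin n, a.coeff j • t.logForm j := by
  rcases subsingleton_or_nontrivial B with _ | _
  · have := Module.subsingleton B t.F
    exact ⟨0, Subsingleton.elim _ _⟩
  obtain ⟨a, ha⟩ := h₀
  obtain ⟨m, b, hb, hab⟩ := h₁
  change t.ofPoly a = t.ofPoly t.P * f at ha
  change t.ofPoly t.P ^ m * (t.ofPoly X * f) = t.ofPoly b at hab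
  have hinj : Function.Injective t.ofPoly :=
    IsLocalization.injective t.F (M := Submonoid.powers t.P)
      (Submonoid.powers_le.2 t.monic_P.mem_nonZeroDivisors)
  have e : t.P ^ m * (X * a) = t.P * b := by
    apply hinj
    simp only [map_mul, map_pow]
    rw [ha, ← hab]
    ring
  have hdeg : a = 0 ∨ a.natDegree < n := by
    by_cases h0 : a = 0
    · exact Or.inl h0
    right
    have e' := congrArg natDegree e
    have hX : (X * a).natDegree = a.natDegree + 1 := natDegree_X_mul h0
    have hX0 : X * a ≠ 0 := fun h => by simp [h] at hX
    rw [(t.monic_P.pow m).natDegree_mul' hX0, t.monic_P.natDegree_pow, t.natDegree_P, hX] at e'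
    have h3 := natDegree_mul_le_of_le (t.natDegree_P_le) hb
    rw [← e', mul_comm m n] at h3
    omega
  have hf : f = t.ofPoly a * t.invP := by
    rw [ha]
    linear_combination (-f) * t.P_mul_invP
  refine ⟨a, ?_⟩
  rcases hdeg with rfl | hdeg
  · simp [hf]
  · rw [hf, t.ofPoly_mul_invP_eq_sum hdeg, Finset.sum_range]

theorem globalForm_eq_sum (f : (t.log₀ ⊓ t.logInf : Submodule B t.F)) (a : B[X])
    (h : (f : t.F) = ∑ j : Fin n, a.coeff j • t.logForm j) :
    t.globalForm f = ∑ j : Fin n, a.coeff j • t.logClass j := by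
  simp only [logClass, ← map_smul, ← map_sum]
  congr 1
  ext
  rw [h]
  simp

theorem span_logClass : Submodule.span B (Set.range t.logClass) = ⊤ := by
  rw [eq_top_iff]
  intro e _
  obtain ⟨f, rfl⟩ := t.globalForm_surjective e
  obtain ⟨a, ha⟩ := t.eq_sum_logForm f.2.1 f.2.2
  rw [t.globalForm_eq_sum f a ha]
  exact Submodule.sum_mem _ fun j _ => Submodule.smul_mem _ _ (Submodule.subset_span ⟨j, rfl⟩)

/-- The relation coming from `∇ 1 = h dP / P`. -/
theorem sum_coeff_logClass (hn : n ≠ 0) :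
    t.h • ∑ j : Fin n, (derivative t.P).coeff j • t.logClass j = 0 := by
  have hd : (derivative t.P).natDegree < n := by
    have := t.natDegree_derivative_P_le
    omega
  have h1 : (1 : t.F) ∈ t.regInf := ⟨0, 1, by simp, by simp⟩
  -- The constant function 1 on both charts has zero Čech difference, so its coboundary is the
  -- global form `∇ 1`.
  have hB : t.d0 (1, 1) ∈ t.B1 := ⟨(1, 1), ⟨⟨1, by simp⟩, h1⟩, rfl⟩
  obtain ⟨k₁, k₂, -⟩ := t.B1_le_Z1 hB
  have hform : t.nabla t.ddx 1 = ∑ j : Fin n, (C t.h * derivative t.P).coeff j • t.logForm j := by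
    have e := t.nabla_ofPoly 1
    rw [map_one] at e
    rw [e, derivative_one, zero_mul, zero_add, mul_one,
      t.ofPoly_mul_invP_eq_sum ((natDegree_C_mul_le _ _).trans_lt hd), Finset.sum_range]
  have hsum := t.globalForm_eq_sum ⟨t.nabla t.ddx 1, k₁, k₂⟩ _ hform
  simp only [coeff_C_mul, mul_smul, ← Finset.smul_sum] at hsum
  rw [← hsum]
  refine (Submodule.Quotient.mk_eq_zero _).2 ?_
  change ((t.nabla t.ddx 1, t.nabla t.ddx 1, 0) : t.F × t.F × t.F) ∈ t.B1
  convert hB using 1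
  refine Prod.ext rfl (Prod.ext rfl ?_)
  exact (sub_self (1 : t.F)).symm

/-! ### Base change and restriction to `U` -/

section

variable {B' : Type*} [CommRing B'] [Algebra B B']

theorem restrictU_logClass (j : Fin n) :
    t.restrictU (1 ⊗ₜ t.logClass j : B' ⊗[B] t.E) =
      Submodule.Quotient.mk ((t.map (algebraMap B B')).logForm j) := by
  refine (t.restrictU_tmul 1 _).trans ?_
  rw [one_smul]
  congr 1
  change t.mapF (algebraMap B B') (t.ofPoly (X ^ (j : ℕ)) * t.invP) = _
  rw [map_mul, mapF_invP, mapF_ofPoly, Polynomial.map_pow, map_X, logForm]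

theorem restrictU_surjective (hn : n ≠ 0)
    (hh : ∀ k : ℕ, IsUnit (n * (t.map (algebraMap B B')).h + k))
    (hh' : ∀ k : ℕ, IsUnit ((t.map (algebraMap B B')).h - k)) :
    Function.Surjective (t.restrictU : B' ⊗[B] t.E →ₗ[B'] _) := by
  intro e
  obtain ⟨f, rfl⟩ := Submodule.Quotient.mk_surjective _ e
  have hf : f ∈ (t.map (algebraMap B B')).exactLog := by
    rw [exactLog_eq_top _ hn hh hh']; trivial
  obtain ⟨_, ⟨g, rfl⟩, ω, hω, rfl⟩ := Submodule.mem_sup.1 hf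
  have hle : Submodule.span B' (Set.range fun j : Fin n => (t.map (algebraMap B B')).logForm j) ≤
      (LinearMap.range (t.restrictU : B' ⊗[B] t.E →ₗ[B'] _)).comap (Submodule.mkQ _) := by
    rw [Submodule.span_le]
    rintro _ ⟨j, rfl⟩
    exact ⟨1 ⊗ₜ t.logClass j, t.restrictU_logClass j⟩
  obtain ⟨x, hx⟩ := hle hω
  refine ⟨x, hx.trans ?_⟩
  refine (Submodule.Quotient.eq _).2 ⟨-g, ?_⟩
  rw [map_neg]
  ring

/-- After base change making `h` and `n` invertible, the logarithmic forms of order less than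
`n - 1` generate `E`. -/
theorem span_baseChange_logClass (hn : IsUnit (n : B')) (hn0 : n ≠ 0)
    (hh : IsUnit (algebraMap B B' t.h)) :
    Submodule.span B' (Set.range fun j : Fin (n - 1) =>
      (1 ⊗ₜ t.logClass (j.castLE (Nat.sub_le n 1)) : B' ⊗[B] t.E)) = ⊤ := by
  set N := Submodule.span B' (Set.range fun j : Fin (n - 1) =>
    (1 ⊗ₜ t.logClass (j.castLE (Nat.sub_le n 1)) : B' ⊗[B] t.E)) with hN
  have hlt : ∀ j : Fin n, (j : ℕ) < n - 1 → (1 ⊗ₜ t.logClass j : B' ⊗[B] t.E) ∈ N :=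
    fun j hj => Submodule.subset_span ⟨⟨j, hj⟩, rfl⟩
  -- The coefficient of `x^{n-1}` in `P'` is `n`; as `h` and `n` are units in `B'`, the relation
  -- expresses the last class through the others.
  let l : Fin n := ⟨n - 1, by omega⟩
  have hl : (1 ⊗ₜ t.logClass l : B' ⊗[B] t.E) ∈ N := by
    have hrel := congrArg (fun e => (1 ⊗ₜ e : B' ⊗[B] t.E)) (t.sum_coeff_logClass hn0)
    simp only [TensorProduct.tmul_smul, TensorProduct.tmul_sum, TensorProduct.tmul_zero] at hrel
    rw [← algebraMap_smul B', ← Finset.sum_erase_add _ _ (Finset.mem_univ l)] at hrel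
    have h0 : algebraMap B B' t.h • (∑ j ∈ Finset.univ.erase l, (derivative t.P).coeff j •
        (1 ⊗ₜ t.logClass j : B' ⊗[B] t.E) + (derivative t.P).coeff l • (1 ⊗ₜ t.logClass l)) ∈ N := by
      rw [hrel]; exact zero_mem _
    rw [Submodule.smul_mem_iff_of_isUnit _ hh, Submodule.add_mem_iff_right, t.coeff_derivative_P hn0,
      ← algebraMap_smul B', map_natCast, Submodule.smul_mem_iff_of_isUnit _ hn] at h0
    · exact h0
    · refine Submodule.sum_mem _ fun j hj => ?_
      rw [← algebraMap_smul B']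
      refine Submodule.smul_mem _ _ (hlt j ?_)
      have h1 : (j : ℕ) ≠ n - 1 := fun h => Finset.ne_of_mem_erase hj (Fin.ext h)
      have := j.2
      omega
  have hall : ∀ j : Fin n, (1 ⊗ₜ t.logClass j : B' ⊗[B] t.E) ∈ N := by
    intro j
    by_cases hj : (j : ℕ) < n - 1
    · exact hlt j hj
    · have : j = l := Fin.ext (by have := j.2; simp only [l]; omega)
      rwa [this]
  rw [eq_top_iff, ← Submodule.baseChange_top (A := B') (M := t.E), ← t.span_logClass,
    Submodule.baseChange_span, Submodule.span_le]
  rintro _ ⟨_, ⟨j, rfl⟩, rfl⟩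
  exact hall j

/-- On `U` the correction by the Lagrange vector field is exact, so the Gauss–Manin connection is
induced there by `∇` along the lift of `D'` fixing `x`. Testing against a map `c` that turns this
operator into `ψ` avoids a separate connection on the cohomology of `U`. -/
theorem restrictU_gaussManinBaseChange (D : Derivation ℤ B B) (hD : D t.h = 0)
    (D' : Derivation ℤ B' B') (hD' : ∀ b, D' (algebraMap B B' b) = algebraMap B B' (D b))
    {M : Type*} [AddCommGroup M] [Module B' M] (c : (t.map (algebraMap B B')).H1U →ₗ[B'] M)
    (ψ : M →+ M) (hψ : ∀ f, c (Submodule.Quotient.mk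
      ((t.map (algebraMap B B')).nabla ((t.map (algebraMap B B')).lift D') f)) =
      ψ (c (Submodule.Quotient.mk f))) (e : B' ⊗[B] t.E) :
    c (t.restrictU (t.gaussManinBaseChange D hD D' hD' e)) = ψ (c (t.restrictU e)) := by
  have hlift : ∀ f, t.mapF (algebraMap B B') (t.lift D f) =
      (t.map (algebraMap B B')).lift D' (t.mapF (algebraMap B B') f) := by
    refine leibniz_ext (Submonoid.powers t.P) (t.mapF (algebraMap B B'))
      (fun f => t.mapF (algebraMap B B') (t.lift D f))
      (fun f => (t.map (algebraMap B B')).lift D' (t.mapF (algebraMap B B') f)) ?_ ?_ ?_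
    · intro x y
      simp only [Derivation.leibniz, smul_eq_mul, map_add, map_mul]
    · intro x y
      simp only [Derivation.leibniz, smul_eq_mul, map_mul]
    · intro a
      change t.mapF (algebraMap B B') (t.lift D (t.ofPoly a)) =
        (t.map (algebraMap B B')).lift D' (t.mapF (algebraMap B B') (t.ofPoly a))
      rw [lift_ofPoly, mapF_ofPoly, mapF_ofPoly, lift_ofPoly]
      congr 1
      ext i
      rw [coeff_map, coeff_coeffDer, coeff_coeffDer, coeff_map, hD']
  have hnabla : ∀ f, t.mapF (algebraMap B B') (t.nabla (t.lift D) f) =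
      (t.map (algebraMap B B')).nabla ((t.map (algebraMap B B')).lift D')
        (t.mapF (algebraMap B B') f) := by
    intro f
    rw [nabla_apply, nabla_apply, map_add, map_mul, map_mul, map_mul, mapF_invP, hlift, hlift,
      algebraMap_eq, algebraMap_eq, mapF_ofPoly, mapF_ofPoly, Polynomial.map_C, map_P]
    rfl
  induction e with
  | zero => simp
  | add x y hx hy => simp only [map_add, hx, hy]
  | tmul b e =>
    obtain ⟨x, rfl⟩ := Submodule.Quotient.mk_surjective _ e
    change c (t.restrictU (D' b ⊗ₜ Submodule.Quotient.mk x +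
      b ⊗ₜ Submodule.Quotient.mk (t.gmCocycle D hD x))) = _
    rw [map_add, restrictU_tmul, restrictU_tmul, restrictU_tmul, ← Submodule.Quotient.mk_smul,
      ← Submodule.Quotient.mk_smul, ← Submodule.Quotient.mk_smul, ← hψ,
      ← Submodule.Quotient.mk_add]
    congr 1
    -- The primitive is the base change of `v ω₀`, the contraction of `ω₀ dx` with `v ∂/∂x`, scaled
    -- by `b`.
    refine (Submodule.Quotient.eq _).2
      ⟨b • t.mapF (algebraMap B B') (t.ofPoly (t.lagrange D) * x.1.1), ?_⟩
    change _ = D' b • t.mapF (algebraMap B B') x.1.1 + b • t.mapF (algebraMap B B')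
      (t.nabla (t.lift D) x.1.1 + t.nabla t.ddx (t.ofPoly (t.lagrange D) * x.1.1)) - _
    rw [map_smul, map_add, mapF_nabla, hnabla, Algebra.smul_def b (t.mapF _ x.1.1), nabla_mul,
      lift_algebraMap, Algebra.smul_def, Algebra.smul_def, Algebra.smul_def]
    ring

end

/-! ### Bijectivity -/

/-- The map induced by the Cartier map on the relative de Rham cohomology of `U`. -/
def cartierH1 {p : ℕ} (hp : p.Prime) (hpB : (p : B) = 0) : t.H1U →ₗ[B] t.Crit :=
  Submodule.liftQ _ (t.cartier p) (by rintro _ ⟨f, rfl⟩; exact t.cartier_nabla hp hpB f)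

/-- By Fermat and Frobenius, `u = a h + k` satisfies `u^p - u = a (h^p - h)`, which is a unit
divisible by `u`. -/
theorem isUnit_mul_add_of_isUnit_pow_sub {p : ℕ} [Fact p.Prime]
    (hpB : (p : B) = 0) {h : B} (hh : IsUnit (h ^ p - h)) {a : ℤ} (ha : IsUnit (a : B)) (k : ℤ) :
    IsUnit (a * h + k : B) := by
  have hp : p.Prime := Fact.out
  have hfer : ∀ m : ℤ, (m : B) ^ p = m := by
    intro m
    have h1 : ((m ^ p - m : ℤ) : ZMod p) = 0 := by simp [ZMod.pow_card]
    obtain ⟨c, hc⟩ := (ZMod.intCast_zmod_eq_zero_iff_dvd _ _).1 h1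
    have e := congrArg (Int.cast : ℤ → B) hc
    push_cast at e
    rw [hpB, zero_mul] at e
    exact sub_eq_zero.1 e
  obtain ⟨r, hr⟩ := exists_add_pow_prime_eq hp (a * h : B) (k : B)
  rw [hpB, mul_pow, hfer, hfer] at hr
  have e : (a * h + k : B) ^ p - (a * h + k) = a * (h ^ p - h) := by linear_combination hr
  refine isUnit_of_dvd_unit ?_ (ha.mul hh)
  rw [← e]
  exact dvd_sub (dvd_pow_self _ hp.ne_zero) dvd_rfl

/-- Injectivity follows from surjectivity: precomposing with `n - 1` generators of the source gives
a surjective endomorphism of a free module of rank `n - 1`, hence an injective one. Freeness of `E`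
need not be known beforehand. -/
theorem bijective_cartierH1_restrictU {B' : Type*} [CommRing B'] [Algebra B B']
    {p : ℕ} [hp : Fact p.Prime] (hpB : (p : B') = 0) (hn0 : n ≠ 0)
    (hn : IsUnit (n : B')) (ht : (t.map (algebraMap B B')).IsEtaleCrit)
    (hh : IsUnit ((t.map (algebraMap B B')).h ^ p - (t.map (algebraMap B B')).h)) :
    Function.Bijective
      ((t.map (algebraMap B B')).cartierH1 hp.out hpB ∘ₗ t.restrictU) := by
  set Φ := (t.map (algebraMap B B')).cartierH1 hp.out hpB ∘ₗ t.restrictU with hΦ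
  have hsurj : Function.Surjective Φ := by
    rw [hΦ, LinearMap.coe_comp]
    refine Function.Surjective.comp ?_ (t.restrictU_surjective hn0 (fun k => ?_) fun k => ?_)
    · intro c
      obtain ⟨f, rfl⟩ := (t.map (algebraMap B B')).cartier_surjective hp.out hpB hn ht c
      exact ⟨Submodule.Quotient.mk f, rfl⟩
    · simpa using isUnit_mul_add_of_isUnit_pow_sub hpB hh (a := n) (by simpa using hn) k
    · simpa [sub_eq_add_neg] using
        isUnit_mul_add_of_isUnit_pow_sub hpB hh (a := 1) (by simp) (-(k : ℤ))
  refine ⟨?_, hsurj⟩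
  rcases subsingleton_or_nontrivial B' with _ | _
  · have := Module.subsingleton B' (B' ⊗[B] t.E)
    exact Function.injective_of_subsingleton _
  obtain ⟨ε⟩ := (t.map (algebraMap B B')).exists_critEquiv hn
  have hh1 : IsUnit (algebraMap B B' t.h) := by
    simpa using! isUnit_mul_add_of_isUnit_pow_sub hpB hh (a := 1) (by simp) 0
  let γ : (Fin (n - 1) → B') →ₗ[B'] B' ⊗[B] t.E := Fintype.linearCombination B'
    fun j : Fin (n - 1) => 1 ⊗ₜ t.logClass (j.castLE (Nat.sub_le n 1))
  have hγ : Function.Surjective γ := by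
    rw [← LinearMap.range_eq_top, Fintype.range_linearCombination]
    exact t.span_baseChange_logClass hn hn0 hh1
  have hinj := OrzechProperty.injective_of_surjective_endomorphism (ε.toLinearMap ∘ₗ Φ ∘ₗ γ)
    (ε.surjective.comp (hsurj.comp hγ))
  intro x y hxy
  obtain ⟨x, rfl⟩ := hγ x
  obtain ⟨y, rfl⟩ := hγ y
  exact congrArg γ (hinj (congrArg ε hxy))

end Pt

/-! ### The universal family -/

section Family

variable (n p : ℕ) [Fact p.Prime]

theorem natCast_prime_OFlat : (p : OFlat n p) = 0 := by
  have h : ((p : (ZMod p)[X])) = 0 := by rw [← map_natCast C, ZMod.natCast_self, map_zero]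
  rw [← map_natCast (algebraMap (OS (FH p) n) (OFlat n p)),
    ← map_natCast (algebraMap (FH p) (OS (FH p) n)),
    ← map_natCast (algebraMap (ZMod p)[X] (FH p)), h, map_zero, map_zero, map_zero]

theorem isUnit_natCast_OFlat (hpn : ¬ p ∣ n) : IsUnit (n : OFlat n p) := by
  have hco : IsCoprime (n : ℤ) (p : ℤ) := by
    rw [Nat.isCoprime_iff_coprime, Nat.coprime_comm, (Fact.out : p.Prime).coprime_iff_not_dvd]
    exact hpn
  obtain ⟨a, b, hab⟩ := hco
  have e := congrArg (Int.cast : ℤ → OFlat n p) hab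
  push_cast at e
  rw [natCast_prime_OFlat, mul_zero, add_zero] at e
  exact IsUnit.of_mul_eq_one_right _ e

theorem isUnit_pow_sub_familyFlat :
    IsUnit ((familyFlat n p).h ^ p - (familyFlat n p).h) := by
  have h : (familyFlat n p).h = algebraMap (OS (FH p) n) (OFlat n p)
      (algebraMap (FH p) (OS (FH p) n) (algebraMap (ZMod p)[X] (FH p) X)) := by
    change algebraMap (OS (FH p) n) (OFlat n p) (mapOS n (redH p) (algebraMap _ _ _)) = _
    rw [mapOS_algebraMap', redH_h]
  rw [h, ← map_pow, ← map_pow, ← map_pow, ← map_sub, ← map_sub, ← map_sub]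
  exact ((IsLocalization.Away.algebraMap_isUnit (X ^ p - X : (ZMod p)[X])).map _).map _

theorem dOFlat_h (i : Fin n) : dOFlat n p i (familyFlat n p).h = 0 := by
  change dOFlat n p i (algebraMap (O n) (OFlat n p) (family n).h) = 0
  rw [dOFlat_algebraMap, dO_h, map_zero]

end Family

end

end KZ

theorem mainTheorem3 (n p : ℕ) (hn : 1 < n) [Fact p.Prime] (hp : p ≠ 2) (hpn : ¬ p ∣ n) :
    ∃ C : (KZ.familyFlat n p).H1U →ₗ[KZ.OFlat n p] KZ.LFlat n p,
      (∀ f, C (Submodule.Quotient.mk f) = (KZ.familyFlat n p).cartier p f) ∧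
      Function.Bijective (C ∘ₗ (KZ.family n).restrictU) ∧
      ∀ (i : Fin n) (e : KZ.EFlat n p),
        C ((KZ.family n).restrictU (KZ.nablaE n p i e)) =
          KZ.nablaL n p i (C ((KZ.family n).restrictU e)) := by
  have hp' : p.Prime := Fact.out
  have hpB := KZ.natCast_prime_OFlat n p
  refine ⟨(KZ.familyFlat n p).cartierH1 hp' hpB, fun f => rfl,
    (KZ.family n).bijective_cartierH1_restrictU hpB (by omega) (KZ.isUnit_natCast_OFlat n p hpn)
      (KZ.isEtaleCrit_familyFlat n p) (KZ.isUnit_pow_sub_familyFlat n p), fun i e => ?_⟩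
  exact (KZ.family n).restrictU_gaussManinBaseChange (KZ.dO n i) (KZ.dO_h n i) (KZ.dOFlat n p i)
    (KZ.dOFlat_algebraMap n p i) ((KZ.familyFlat n p).cartierH1 hp' hpB)
    (KZ.nablaL n p i).toAddMonoidHom (fun f => (KZ.familyFlat n p).cartier_nabla_lift hp' hpB
      (KZ.isEtaleCrit_familyFlat n p) (KZ.dOFlat n p i) (KZ.dOFlat_h n p i) f) e
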